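/- Let $q$ be a prime power. For subspaces $U,V\subseteq\mathbb F_q^n$ put $d_S(U,V)=\dim(U+V)-\dim(U\cap V)$. For a set $\mathcal C$ of subspaces of $\mathbb F_q^n$ let $\eta_i(\mathcal C)$ be the number of $i$-dimensional members of $\mathcal C$. Let $A_q(n,d,\{k\})$ be the maximum size of a nonempty set of $k$-dimensional subspaces of $\mathbb F_q^n$ in which any two distinct members have subspace distance at least $d$. For $T\subseteq\{0,1,\dots,n\}$, an $(n,d_1,d_0,T)_q$ mixed dimension/distance subspace code (MDDC) is a set $\mathcal C$ of subspaces of $\mathbb F_q^n$ such that $\eta_i(\mathcal C)>0$ exactly for $i\in T$, and, for distinct $U,V\in\mathcal C$, $d_S(U,V)\ge d_1$ if $\dim U=\dim V$ and $d_S(U,V)\ge d_0$ if $\dim U\ne\dim V$. For a nonempty finite set $T$ of positive integers let $T^{\min}$ be its minimum, and let $l_T=\min\{u-v: u,v\in T,\ u>v\}$ if $|T|>1$ and $l_T=0$ if $|T|=1$. Write $\begin{bmatrix}a\\ b\end{bmatrix}_q=\prod_{i=0}^{b-1}\frac{q^a-q^i}{q^b-q^i}$ and \[ \Delta(m,n,d)_q=q^{\max\{m,n\}(\min\{m,n\}-d+1)},\qquad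 \Delta(m,n,d;r)_q=1+\sum_{i=d}^{r}D(m,n,d,i)_q, \] \[ D(m,n,d,i)_q=\begin{bmatrix}\min\{m,n\}\\ i\end{bmatrix}_q\sum_{j=0}^{i-d}(-1)^jq^{\frac{j(j-1)}{2}}\begin{bmatrix}i\\ j\end{bmatrix}_q\bigl(q^{\max\{m,n\}(i-d-j+1)}-1\bigr), \] where the sum over $i$ is empty if $r<d$. **Theorem.** Let $n,n_1,n_2,k,\delta$ be integers with $n=n_1+n_2$, $n_1\ge k$, $n_2\ge k$ and $k\ge 2\delta\ge 4$. Let $T_1$ be a nonempty set of integers contained in $[\delta,k]$ with $l_{T_1}<2\delta$, and assume $n_1+k-T_1^{\min}\le n-k$. Let \[ \theta_1=\Bigl\lfloor\tfrac{n_1-T_1^{\min}}{\delta}\Bigr\rfloor,\qquad \theta_2=\min\Bigl\{\Bigl\lfloor\tfrac{k}{\delta}\Bigr\rfloor-1,\ \Bigl\lfloor\tfrac{n_2-k+T_1^{\min}}{\delta}\Bigr\rfloor-2\Bigr\}. \] For $0\le i\le\theta_1$ and $0\le j\le\theta_2$ let \[ \Lambda_1^i=\max\{k-\delta,\ n_1-T_1^{\min}+(1-i)\delta\},\quad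 \Gamma^i=\min\{k-\delta,\ n_1-T_1^{\min}+(1-i)\delta\},\quad \Lambda_3^j=n_2-k+T_1^{\min}-(j+1)\delta, \] let $d_1^{(i,j)}=\lceil\delta/2\rceil$ if $\Lambda_1^i\ge\Lambda_3^j$ and $d_1^{(i,j)}=\lfloor\delta/2\rfloor$ otherwise, and let $d_2^{(i,j)}=\delta-d_1^{(i,j)}$. If $\mathcal X_1$ is an $(n_1,2\delta,2\delta-l_{T_1},T_1)_q$ MDDC, then \[ \begin{aligned} A_q(n,2\delta,\{k\})\ \ge\ &\sum_{t\in T_1}\eta_t(\mathcal X_1)\,\Delta(k,n_2+t-k,\delta)_q+\Delta(k,n-k,\delta;k-\delta)_q\\ &+\Delta(k-\delta,\ n_2-k+T_1^{\min}-\delta,\ \delta;\ k-2\delta)_q\cdot\sum_{i=0}^{\theta_1}\sum_{j=0}^{\theta_2}q^{\min\{\Lambda_1^id_2^{(i,j)},\ \Lambda_3^jd_1^{(i,j)}\}+\Lambda_1^i(\Gamma^i-\delta+1)+\Lambda_3^j}. \end{aligned} \] -/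

import Mathlib

namespace CDC

section Subspaces

variable {F : Type*} [Field F] {n : ℕ}

/-- The subspace distance `dim (U + V) - dim (U ∩ V)` on the subspaces of `F ^ n`. -/
noncomputable def subspaceDist (U V : Submodule F (Fin n → F)) : ℕ :=
  Module.finrank F ↥(U ⊔ V) - Module.finrank F ↥(U ⊓ V)

/-- The dimension distribution: `eta C i` is the number of `i`-dimensional codewords of `C`. -/
noncomputable def eta (C : Set (Submodule F (Fin n → F))) (i : ℕ) : ℕ :=
  {U : Submodule F (Fin n → F) | U ∈ C ∧ Module.finrank F U = i}.ncard

/-- `C` is an `(n, d, T)_q` subspace code. -/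
structure IsSubspaceCode (C : Set (Submodule F (Fin n → F))) (d : ℕ) (T : Finset ℕ) : Prop where
  nonempty : C.Nonempty
  dist : ∀ U ∈ C, ∀ V ∈ C, U ≠ V → d ≤ subspaceDist U V
  dims : ∀ i, 0 < eta C i ↔ i ∈ T

/-- `C` is an `(n, d₁, d₀, T)_q` mixed dimension/distance subspace code (MDDC). -/
structure IsMDDC (C : Set (Submodule F (Fin n → F))) (d₁ d₀ : ℕ) (T : Finset ℕ) : Prop where
  dist_same : ∀ U ∈ C, ∀ V ∈ C, U ≠ V →
    Module.finrank F U = Module.finrank F V → d₁ ≤ subspaceDist U V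
  dist_diff : ∀ U ∈ C, ∀ V ∈ C,
    Module.finrank F U ≠ Module.finrank F V → d₀ ≤ subspaceDist U V
  dims : ∀ i, 0 < eta C i ↔ i ∈ T

end Subspaces

/-- `A_q(n, d, {k})`, where `F` is a field with `q` elements: the maximum size of a constant
dimension code of `k`-dimensional subspaces of `F ^ n` with subspace distance at least `d`. -/
noncomputable def maxCDC (F : Type*) [Field F] (n d k : ℕ) : ℕ :=
  sSup {N : ℕ | ∃ C : Set (Submodule F (Fin n → F)), IsSubspaceCode C d {k} ∧ C.ncard = N}

/-- `l_T`: the smallest difference of two distinct elements of `T`, and `0` if `|T| ≤ 1`. -/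
noncomputable def minGap (T : Finset ℕ) : ℕ :=
  if 1 < T.card then sInf {g : ℕ | ∃ u ∈ T, ∃ v ∈ T, v < u ∧ g = u - v} else 0

/-- The `q`-ary Gaussian binomial coefficient. -/
def gaussBinom (q n k : ℕ) : ℚ :=
  ∏ i ∈ Finset.range k, ((q : ℚ) ^ n - (q : ℚ) ^ i) / ((q : ℚ) ^ k - (q : ℚ) ^ i)

/-- `Δ(m, n, d)_q`, the size of an `m × n` MRD code with minimum rank distance `d`
(for `1 ≤ d ≤ min m n`). -/
def mrdSize (q m n d : ℕ) : ℕ :=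
  q ^ (max m n * (min m n - d + 1))

/-- `D(m, n, d, i)_q`, the number of matrices of rank `i` in a linear `m × n` MRD code with
minimum rank distance `d`, by Delsarte's formula (for `1 ≤ d ≤ i ≤ min m n`). -/
def rankDist (q m n d i : ℕ) : ℚ :=
  gaussBinom q (min m n) i *
    ∑ j ∈ Finset.range (i - d + 1),
      (-1 : ℚ) ^ j * (q : ℚ) ^ (j * (j - 1) / 2) * gaussBinom q i j *
        ((q : ℚ) ^ (max m n * (i - d - j + 1)) - 1)

/-- `Δ(m, n, d; r)_q = 1 + ∑_{i=d}^{r} D(m, n, d, i)_q`; the sum is empty if `r < d`. -/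
def mrdSizeRestr (q m n d r : ℕ) : ℚ :=
  1 + ∑ i ∈ Finset.Icc d r, rankDist q m n d i

end CDC

set_option linter.unusedSectionVars false

/-! A union of three families of `k`-dimensional subspaces of `F ^ n` is a valid code, where two
distinct members may meet in dimension at most `k - δ`. Let `τ` be the minimum of `T₁`. The first
family (`exists_packing_lift`) consists of the spaces `{(u | p | M (u, p))}` with `u` in a codeword
of `X₁` and `M` in an MRD code. The second (`exists_packing_rev`) consists of the spaces `{(N x |
x)}` with `N` an MRD codeword of rank at most `k - δ`. The third (`exists_packing_stair`) consists
of row spaces of block matrices split after coordinate `n₁ + k - τ`, with identity blocks shifted by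
multiples of `δ`. Across families one principle suffices (`finrank_inf_add_le_of_ker`): if a
coordinate projection is injective on `Z₁` but kills a subspace of `Z₂` of dimension at least `δ`,
then `Z₁ ⊓ Z₂` has codimension at least `δ` in `Z₂`. The projections are onto the first `n - k`
coordinates (first against second family), the first `n₁ + k - τ` (first against third) and the last
`k` (second against third); `n₁ + k - τ ≤ n - k` makes these choices compatible. The sizes rest on
Gabidulin codes (`exists_gabidulin`), where the number of codewords vanishing on a subspace depends
only on its dimension; double counting and `q`-binomial inversion then give Delsarte's rank
distribution. These codes are nested, and gluing two nested pairs along a common complement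
(`exists_pair_code`) gives the exponents in the double sum. -/

namespace CDC

/-! ### Gaussian binomial identities and `q`-binomial inversion. -/

section GaussBinom

/-- The unnormalised `q`-factorial `∏_{i=1}^{n} (q ^ i - 1)`. -/
def qFact (q n : ℕ) : ℚ := ∏ i ∈ Finset.range n, ((q : ℚ) ^ (i + 1) - 1)

theorem qFact_succ (q n : ℕ) : qFact q (n + 1) = qFact q n * ((q : ℚ) ^ (n + 1) - 1) :=
  Finset.prod_range_succ _ _

theorem qFact_ne_zero {q : ℕ} (hq : 1 < q) (n : ℕ) : qFact q n ≠ 0 := by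
  refine Finset.prod_ne_zero_iff.2 fun i _ => ?_
  have : (1 : ℚ) < (q : ℚ) ^ (i + 1) := one_lt_pow₀ (by exact_mod_cast hq) (by omega)
  linarith

theorem prod_pow_sub_pow_mul_qFact (q : ℕ) {n k : ℕ} (hk : k ≤ n) :
    (∏ i ∈ Finset.range k, ((q : ℚ) ^ n - (q : ℚ) ^ i)) * qFact q (n - k)
      = (∏ i ∈ Finset.range k, (q : ℚ) ^ i) * qFact q n := by
  induction k with
  | zero => simp
  | succ k ih =>
    rw [Finset.prod_range_succ, Finset.prod_range_succ]
    have h1 : n - k = (n - (k + 1)) + 1 := by omega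
    have h2 := ih (by omega)
    rw [h1, qFact_succ, ← h1] at h2
    have h3 : (q : ℚ) ^ n = (q : ℚ) ^ k * (q : ℚ) ^ (n - k) := by
      rw [← pow_add]; congr 1; omega
    calc _ = (q : ℚ) ^ k * ((∏ i ∈ Finset.range k, ((q : ℚ) ^ n - (q : ℚ) ^ i)) *
          (qFact q (n - (k + 1)) * ((q : ℚ) ^ (n - k) - 1))) := by
          rw [h3]; ring
      _ = _ := by rw [h2]; ring

theorem gaussBinom_eq_qFact {q : ℕ} (hq : 1 < q) {n k : ℕ} (hk : k ≤ n) :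
    gaussBinom q n k = qFact q n / (qFact q k * qFact q (n - k)) := by
  have h1 := prod_pow_sub_pow_mul_qFact q hk
  have h2 := prod_pow_sub_pow_mul_qFact q (le_refl k)
  have h0 : (∏ i ∈ Finset.range k, (q : ℚ) ^ i) ≠ 0 :=
    Finset.prod_ne_zero_iff.2 fun i _ => pow_ne_zero _ (by exact_mod_cast (by omega : q ≠ 0))
  have h3 := qFact_ne_zero hq (n - k)
  have h4 := qFact_ne_zero hq k
  have h5 : qFact q (k - k) = 1 := by simp [qFact]
  rw [h5, mul_one] at h2
  rw [gaussBinom, Finset.prod_div_distrib, h2, div_eq_div_iff (by positivity) (by positivity)]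
  linear_combination (qFact q k) * h1

theorem gaussBinom_eq_zero (q : ℕ) {n k : ℕ} (hk : n < k) : gaussBinom q n k = 0 :=
  Finset.prod_eq_zero (Finset.mem_range.2 hk) (by simp)

theorem gaussBinom_zero_right (q n : ℕ) : gaussBinom q n 0 = 1 := by simp [gaussBinom]

theorem gaussBinom_self {q : ℕ} (hq : 1 < q) (n : ℕ) : gaussBinom q n n = 1 := by
  have := qFact_ne_zero hq n
  rw [gaussBinom_eq_qFact hq le_rfl, Nat.sub_self, show qFact q 0 = 1 by simp [qFact]]
  field_simp

theorem gaussBinom_symm {q : ℕ} (hq : 1 < q) {n k : ℕ} (hk : k ≤ n) :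
    gaussBinom q n (n - k) = gaussBinom q n k := by
  rw [gaussBinom_eq_qFact hq hk, gaussBinom_eq_qFact hq (Nat.sub_le n k), Nat.sub_sub_self hk,
    mul_comm]

/-- Both sides count flags of a `w`-dimensional space inside an `s`-dimensional one inside an
`n`-dimensional one; the proof is by `q`-factorials. -/
theorem gaussBinom_mul {q : ℕ} (hq : 1 < q) {n s w : ℕ} (hw : w ≤ s) (hs : s ≤ n) :
    gaussBinom q n s * gaussBinom q s w = gaussBinom q n w * gaussBinom q (n - w) (s - w) := by
  rw [gaussBinom_eq_qFact hq hs, gaussBinom_eq_qFact hq hw, gaussBinom_eq_qFact hq (hw.trans hs),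
    gaussBinom_eq_qFact hq (by omega), show n - w - (s - w) = n - s by omega]
  have := qFact_ne_zero hq
  have h1 := this s
  have h2 := this w
  have h3 := this (s - w)
  have h4 := this (n - s)
  have h5 := this (n - w)
  field_simp

theorem gaussBinom_succ_succ {q : ℕ} (hq : 1 < q) (n k : ℕ) :
    gaussBinom q (n + 1) (k + 1)
      = gaussBinom q n k + (q : ℚ) ^ (k + 1) * gaussBinom q n (k + 1) := by
  rcases lt_trichotomy n k with h | h | h
  · rw [gaussBinom_eq_zero q (by omega), gaussBinom_eq_zero q (by omega),
      gaussBinom_eq_zero q (by omega)]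
    ring
  · subst h
    rw [gaussBinom_self hq, gaussBinom_self hq, gaussBinom_eq_zero q (by omega)]
    ring
  · obtain ⟨m, rfl⟩ : ∃ m, n = k + 1 + m := ⟨n - (k + 1), by omega⟩
    rw [gaussBinom_eq_qFact hq (by omega), gaussBinom_eq_qFact hq (by omega),
      gaussBinom_eq_qFact hq (by omega), show k + 1 + m + 1 - (k + 1) = m + 1 by omega,
      show k + 1 + m - k = m + 1 by omega, show k + 1 + m - (k + 1) = m by omega,
      qFact_succ q (k + 1 + m), qFact_succ q k, qFact_succ q m]
    have := qFact_ne_zero hq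
    have h1 := this k
    have h2 := this m
    have hs := this (k + 1)
    have ht := this (m + 1)
    rw [qFact_succ] at hs ht
    have h3 := right_ne_zero_of_mul hs
    have h4 := right_ne_zero_of_mul ht
    field_simp
    ring

/-- The `q`-Pascal rule makes the alternating sum telescope. Truncating at an arbitrary `J` is what
allows induction; the full sum vanishes because `gaussBinom q n J` does for `J > n`. -/
theorem sum_range_alternating_gaussBinom {q : ℕ} (hq : 1 < q) (n J : ℕ) :
    ∑ j ∈ Finset.range (J + 1), (-1 : ℚ) ^ j * (q : ℚ) ^ (j * (j - 1) / 2) *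
      gaussBinom q (n + 1) j = (-1) ^ J * (q : ℚ) ^ ((J + 1) * J / 2) * gaussBinom q n J := by
  induction J with
  | zero => simp [gaussBinom_zero_right]
  | succ J ih =>
    rw [Finset.sum_range_succ, ih, gaussBinom_succ_succ hq]
    have h : (J + 1 + 1) * (J + 1) / 2 = (J + 1) * J / 2 + (J + 1) := by
      rw [show (J + 1 + 1) * (J + 1) = (J + 1) * J + (J + 1) * 2 by ring,
        Nat.add_mul_div_right _ _ (by norm_num)]
    rw [h, Nat.add_sub_cancel]
    ring

theorem sum_alternating_gaussBinom {q : ℕ} (hq : 1 < q) {n : ℕ} (hn : n ≠ 0) :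
    ∑ j ∈ Finset.range (n + 1), (-1 : ℚ) ^ j * (q : ℚ) ^ (j * (j - 1) / 2) *
      gaussBinom q n j = 0 := by
  obtain ⟨m, rfl⟩ := Nat.exists_eq_succ_of_ne_zero hn
  rw [Nat.succ_eq_add_one, sum_range_alternating_gaussBinom hq, gaussBinom_eq_zero q (by omega),
    mul_zero]

/-- `q`-binomial inversion. -/
theorem gaussBinom_inversion {q : ℕ} (hq : 1 < q) (n : ℕ) (M : ℕ → ℚ) {w : ℕ} (hw : w ≤ n) :
    ∑ j ∈ Finset.range (n - w + 1), (-1 : ℚ) ^ j * (q : ℚ) ^ (j * (j - 1) / 2) *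
      gaussBinom q (w + j) w * ∑ v ∈ Finset.range (n + 1), M v * gaussBinom q v (w + j) = M w := by
  simp_rw [Finset.mul_sum]
  rw [Finset.sum_comm, Finset.sum_eq_single_of_mem w (Finset.mem_range.2 (by omega))]
  · rw [Finset.sum_eq_single_of_mem 0 (Finset.mem_range.2 (by omega))]
    · simp [gaussBinom_self hq]
    · intro j _ hj
      rw [gaussBinom_eq_zero q (by omega : w < w + j)]
      ring
  · intro v hv hvw
    rw [Finset.mem_range] at hv
    rcases lt_or_gt_of_ne hvw with h | h
    · refine Finset.sum_eq_zero fun j _ => ?_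
      rw [gaussBinom_eq_zero q (by omega : v < w + j)]
      ring
    -- For `v > w` only `j ≤ v - w` contributes; `gaussBinom_mul` pulls out a constant and leaves a
    -- full alternating sum, which is zero.
    · rw [← Finset.sum_subset (Finset.range_mono (by omega : v - w + 1 ≤ n - w + 1))]
      · have := sum_alternating_gaussBinom hq (by omega : v - w ≠ 0)
        rw [← mul_zero (M v * gaussBinom q v w), ← this, Finset.mul_sum]
        refine Finset.sum_congr rfl fun j hj => ?_
        rw [Finset.mem_range] at hj
        have := gaussBinom_mul hq (by omega : w ≤ w + j) (by omega : w + j ≤ v)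
        rw [show w + j - w = j by omega] at this
        linear_combination ((-1 : ℚ) ^ j * (q : ℚ) ^ (j * (j - 1) / 2) * M v) * this
      · intro j _ hj
        rw [Finset.mem_range, not_lt] at hj
        rw [gaussBinom_eq_zero q (by omega : v < w + j)]
        ring

end GaussBinom

/-! ### Counting subspaces of a finite vector space. -/

section SubspaceCount

variable {F V : Type*} [Field F] [Finite F] [AddCommGroup V] [Module F V] [Finite V]

theorem natCard_linearIndependent {k : ℕ} (hk : k ≤ Module.finrank F V) :
    (Nat.card {s : Fin k → V // LinearIndependent F s} : ℚ)
      = ∏ i ∈ Finset.range k, ((Nat.card F : ℚ) ^ Module.finrank F V - (Nat.card F : ℚ) ^ i) := by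
  have := Fintype.ofFinite F
  rw [card_linearIndependent hk, Finset.prod_range, Nat.cast_prod, Nat.card_eq_fintype_card]
  refine Finset.prod_congr rfl fun i _ => ?_
  rw [Nat.cast_sub (Nat.pow_le_pow_right Fintype.card_pos (by omega))]
  push_cast
  rfl

/-- A linearly independent family in `V` of length `k` is the same as a `k`-dimensional subspace
together with a linearly independent family of length `k` in it. -/
noncomputable def linearIndependentEquivSigma (k : ℕ) :
    {s : Fin k → V // LinearIndependent F s} ≃
      Σ S : {S : Submodule F V // Module.finrank F S = k},
        {s : Fin k → S.1 // LinearIndependent F s} where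
  toFun s := ⟨⟨Submodule.span F (Set.range s.1), by
      simpa using finrank_span_eq_card s.2⟩,
    ⟨fun i => ⟨s.1 i, Submodule.subset_span ⟨i, rfl⟩⟩,
      LinearIndependent.of_comp (Submodule.subtype _) s.2⟩⟩
  invFun p := ⟨fun i => (p.2.1 i : V), p.2.2.map' (Submodule.subtype _) (Submodule.ker_subtype _)⟩
  left_inv s := rfl
  right_inv := by
    rintro ⟨⟨S, hS⟩, ⟨s, hs⟩⟩
    have h : Submodule.span F (Set.range fun i => (s i : V)) = S := by
      have h1 : LinearIndependent F fun i => (s i : V) :=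
        hs.map' (Submodule.subtype _) (Submodule.ker_subtype _)
      refine Submodule.eq_of_le_of_finrank_eq (Submodule.span_le.2 ?_) ?_
      · rintro _ ⟨i, rfl⟩
        exact (s i).2
      · rw [finrank_span_eq_card h1, hS, Fintype.card_fin]
    -- The subspace is generalised to a variable `T`, since the type of the second component depends
    -- on it and only then can the equality be substituted.
    have key : ∀ (T : Submodule F V) (hT : Module.finrank F T = k) (hm : ∀ i, (s i : V) ∈ T)
        (hl : LinearIndependent F fun i => (⟨s i, hm i⟩ : T)), T = S →
        (⟨⟨T, hT⟩, ⟨fun i => ⟨s i, hm i⟩, hl⟩⟩ :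
          Σ S : {S : Submodule F V // Module.finrank F S = k},
            {s : Fin k → S.1 // LinearIndependent F s}) = ⟨⟨S, hS⟩, ⟨s, hs⟩⟩ := by
      rintro T hT hm hl rfl
      rfl
    exact key _ _ _ _ h

/-- Every `k`-dimensional subspace has the same number of ordered bases, so the count is a quotient
of two numbers of independent families. -/
theorem natCard_subspaces (k : ℕ) :
    (Nat.card {S : Submodule F V // Module.finrank F S = k} : ℚ)
      = gaussBinom (Nat.card F) (Module.finrank F V) k := by
  rcases lt_or_ge (Module.finrank F V) k with hk | hk
  · rw [gaussBinom_eq_zero _ hk]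
    have : IsEmpty {S : Submodule F V // Module.finrank F S = k} :=
      ⟨fun S => (Submodule.finrank_le S.1).not_gt (hk.trans_eq S.2.symm)⟩
    simp
  · have hq : 1 < Nat.card F := Finite.one_lt_card
    have h1 := natCard_linearIndependent (F := F) hk
    have := Fintype.ofFinite {S : Submodule F V // Module.finrank F S = k}
    rw [Nat.card_congr (linearIndependentEquivSigma k), Nat.card_sigma, Nat.cast_sum] at h1
    have h2 : ∀ S : {S : Submodule F V // Module.finrank F S = k},
        (Nat.card {s : Fin k → S.1 // LinearIndependent F s} : ℚ)
          = ∏ i ∈ Finset.range k, ((Nat.card F : ℚ) ^ k - (Nat.card F : ℚ) ^ i) := by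
      intro S
      rw [natCard_linearIndependent S.2.ge, S.2]
    simp_rw [h2] at h1
    rw [Finset.sum_const, Finset.card_univ, nsmul_eq_mul, ← Nat.card_eq_fintype_card] at h1
    rw [gaussBinom, Finset.prod_div_distrib, ← h1, mul_div_cancel_right₀]
    refine Finset.prod_ne_zero_iff.2 fun i hi => sub_ne_zero.2 fun h => ?_
    exact (Nat.pow_lt_pow_right hq (Finset.mem_range.1 hi)).ne' (by exact_mod_cast h)

/-- The subspaces of dimension `k` inside a given subspace. -/
theorem natCard_subspaces_le (T : Submodule F V) (k : ℕ) :
    (Nat.card {S : Submodule F V // Module.finrank F S = k ∧ S ≤ T} : ℚ)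
      = gaussBinom (Nat.card F) (Module.finrank F T) k := by
  rw [← natCard_subspaces]
  congr 1
  refine Nat.card_congr (Equiv.symm ?_)
  exact
    { toFun := fun S => ⟨S.1.map T.subtype, by
        rw [Submodule.finrank_map_subtype_eq]; exact S.2, Submodule.map_subtype_le _ _⟩
      invFun := fun S => ⟨S.1.comap T.subtype, by
        rw [← Submodule.finrank_map_subtype_eq, Submodule.map_comap_subtype,
          inf_eq_right.2 S.2.2, S.2.1]⟩
      left_inv := fun S => Subtype.ext
        (Submodule.comap_map_eq_of_injective T.injective_subtype _)
      right_inv := fun S => Subtype.ext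
        ((Submodule.map_comap_subtype _ _).trans (inf_eq_right.2 S.2.2)) }

end SubspaceCount

/-! ### Linearised polynomials and their zeros. -/

section Gabidulin

variable {F K V : Type*} [Field F] [Finite F] [Field K] [Finite K] [Algebra F K]
  [AddCommGroup V] [Module F V] [FiniteDimensional F V]

variable (F K) in
/-- The `i`-th power of the relative Frobenius, as an `F`-linear map. -/
noncomputable def frobPow (i : ℕ) : K →ₗ[F] K :=
  letI := Fintype.ofFinite F
  ((FiniteField.frobeniusAlgHom F K) ^ i).toLinearMap

theorem frobPow_apply (i : ℕ) (x : K) : frobPow F K i x = x ^ Nat.card F ^ i := by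
  let := Fintype.ofFinite F
  simp only [frobPow, AlgHom.toLinearMap_apply, AlgHom.coe_pow,
    FiniteField.coe_frobeniusAlgHom, pow_iterate, Nat.card_eq_fintype_card]

/-- Evaluation of linearised polynomials of `q`-degree less than `r` along `g`. -/
noncomputable def gabMap (g : V →ₗ[F] K) (r : ℕ) : (Fin r → K) →ₗ[K] (V →ₗ[F] K) :=
  Fintype.linearCombination K fun i : Fin r => frobPow F K i ∘ₗ g

theorem gabMap_apply (g : V →ₗ[F] K) (r : ℕ) (a : Fin r → K) (v : V) :
    gabMap g r a v = ∑ i : Fin r, a i * g v ^ Nat.card F ^ (i : ℕ) := by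
  simp [gabMap, Fintype.linearCombination_apply, LinearMap.sum_apply, frobPow_apply]

theorem range_gabMap_mono (g : V →ₗ[F] K) {r r' : ℕ} (h : r ≤ r') :
    LinearMap.range (gabMap g r) ≤ LinearMap.range (gabMap g r') := by
  rw [gabMap, gabMap, Fintype.range_linearCombination, Fintype.range_linearCombination]
  refine Submodule.span_mono ?_
  rintro _ ⟨i, rfl⟩
  exact ⟨Fin.castLE h i, rfl⟩

/-- A linearised polynomial with `r` coefficients has degree at most `q ^ (r - 1)`, fewer than its
at least `q ^ r` distinct zeros on `g(S)`. -/
theorem eq_zero_of_gabMap_eq_zero {g : V →ₗ[F] K} (hg : Function.Injective g) {r : ℕ}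
    {S : Submodule F V} (hS : r ≤ Module.finrank F S) {a : Fin r → K}
    (ha : ∀ v ∈ S, gabMap g r a v = 0) : a = 0 := by
  have hq : 1 < Nat.card F := Finite.one_lt_card
  have : Finite V := Module.finite_of_finite F
  have := Fintype.ofFinite S
  let p : Polynomial K :=
    ∑ i : Fin r, Polynomial.C (a i) * Polynomial.X ^ (Nat.card F ^ (i : ℕ))
  have hp : p = 0 := by
    -- Here `r - 1` truncates, and the strict degree bound could fail for `S` of dimension zero.
    by_cases hr : r = 0
    · subst hr
      simp [p]
    refine Polynomial.eq_zero_of_natDegree_lt_card_of_eval_eq_zero p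
      (f := fun s : S => g s) (fun x y h => Subtype.ext (hg h)) (fun s => ?_) ?_
    · rw [← ha s s.2, gabMap_apply]
      simp [p, Polynomial.eval_finsetSum]
    · rw [← Nat.card_eq_fintype_card, Module.natCard_eq_pow_finrank (K := F)]
      refine lt_of_le_of_lt (b := Nat.card F ^ (r - 1)) ?_
        (Nat.pow_lt_pow_right hq (by omega))
      refine Polynomial.natDegree_sum_le_of_forall_le _ _ fun i _ => ?_
      refine (Polynomial.natDegree_C_mul_X_pow_le _ _).trans ?_
      exact Nat.pow_le_pow_right hq.le (by omega)
  funext i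
  have hc : p.coeff (Nat.card F ^ (i : ℕ)) = a i := by
    simp only [p, Polynomial.finsetSum_coeff, Polynomial.coeff_C_mul_X_pow]
    rw [Finset.sum_eq_single i]
    · simp
    · intro j _ hj
      rw [if_neg]
      intro h
      exact hj (Fin.ext (Nat.pow_right_injective hq h).symm)
    · simp
  rw [← hc, hp]
  simp

/-- Restriction to `S` of the evaluation of linearised polynomials. -/
noncomputable def gabMapOn (g : V →ₗ[F] K) (r : ℕ) (S : Submodule F V) :
    (Fin r → K) →ₗ[K] (S →ₗ[F] K) :=
  LinearMap.lcomp K K S.subtype ∘ₗ gabMap g r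

theorem mem_ker_gabMapOn (g : V →ₗ[F] K) (r : ℕ) (S : Submodule F V) (a : Fin r → K) :
    a ∈ LinearMap.ker (gabMapOn g r S) ↔ S ≤ LinearMap.ker (gabMap g r a) := by
  rw [LinearMap.mem_ker, LinearMap.ext_iff]
  exact ⟨fun h x hx => h ⟨x, hx⟩, fun h x => h x.2⟩

/-- With `dim S` coefficients the restriction to `S` is injective, hence bijective by dimension;
more coefficients keep it surjective, and rank-nullity gives the kernel. -/
theorem finrank_ker_gabMapOn {g : V →ₗ[F] K} (hg : Function.Injective g) (r : ℕ)
    (S : Submodule F V) :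
    Module.finrank K (LinearMap.ker (gabMapOn g r S)) = r - Module.finrank F S := by
  have hinj : ∀ {r'}, r' ≤ Module.finrank F S → LinearMap.ker (gabMapOn g r' S) = ⊥ := by
    intro r' h
    rw [eq_bot_iff]
    intro a ha
    exact eq_zero_of_gabMap_eq_zero hg h fun v hv => (mem_ker_gabMapOn _ _ _ _).1 ha hv
  rcases le_total r (Module.finrank F S) with h | h
  · rw [hinj h, finrank_bot]
    omega
  · have h1 := LinearMap.finrank_range_add_finrank_ker (gabMapOn g r S)
    have h2 := LinearMap.finrank_range_add_finrank_ker (gabMapOn g (Module.finrank F S) S)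
    rw [hinj le_rfl, finrank_bot, add_zero, Module.finrank_fin_fun] at h2
    rw [Module.finrank_fin_fun] at h1
    have h3 : LinearMap.range (gabMapOn g (Module.finrank F S) S)
        ≤ LinearMap.range (gabMapOn g r S) := by
      rw [gabMapOn, gabMapOn, LinearMap.range_comp, LinearMap.range_comp]
      exact Submodule.map_mono (range_gabMap_mono g h)
    have h4 := Submodule.finrank_mono h3
    have h5 : Module.finrank K (LinearMap.range (gabMapOn g r S)) ≤ Module.finrank F S := by
      refine (Submodule.finrank_le _).trans ?_
      rw [Module.finrank_linearMap, Module.finrank_self, mul_one]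
    omega

end Gabidulin

/-! ### Gabidulin codes and Delsarte's rank distribution. -/

section MRD

variable {F V W : Type*} [Field F] [Finite F] [AddCommGroup V] [Module F V] [FiniteDimensional F V]
  [AddCommGroup W] [Module F W] [FiniteDimensional F W]

/-- Nested linear MRD codes (Gabidulin): in the `r`-th code the number of maps vanishing on a
subspace `S` is `q ^ (m * (r - dim S))`. -/
theorem exists_gabidulin (hVW : Module.finrank F V ≤ Module.finrank F W)
    (hW : 0 < Module.finrank F W) :
    ∃ G : ℕ → Submodule F (V →ₗ[F] W), Monotone G ∧ ∀ r ≤ Module.finrank F V,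
      ∀ S : Submodule F V, Nat.card {f : V →ₗ[F] W // f ∈ G r ∧ S ≤ LinearMap.ker f}
        = Nat.card F ^ (Module.finrank F W * (r - Module.finrank F S)) := by
  obtain ⟨p, hp⟩ := CharP.exists F
  have : Fact p.Prime := ⟨CharP.char_is_prime F p⟩
  have : NeZero (Module.finrank F W) := ⟨hW.ne'⟩
  -- `K` has degree `dim W` over `F`, so it is a copy of `W`, it has room for `V`, and each
  -- `K`-dimension contributes a factor `q ^ dim W`.
  let K := FiniteField.Extension F p (Module.finrank F W)
  have hK : Module.finrank F K = Module.finrank F W := FiniteField.finrank_extension F p _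
  let e : K ≃ₗ[F] W := LinearEquiv.ofFinrankEq _ _ hK
  obtain ⟨g, hg⟩ : ∃ g : V →ₗ[F] K, Function.Injective g := by
    exact finrank_le_iff_exists_linearMap.1 (hVW.trans hK.ge)
  let Φ : ∀ r, (Fin r → K) →ₗ[F] (V →ₗ[F] W) := fun r =>
    e.congrRight.toLinearMap ∘ₗ (gabMap g r).restrictScalars F
  have hΦ : ∀ r a v, Φ r a v = e (gabMap g r a v) := fun r a v => rfl
  refine ⟨fun r => LinearMap.range (Φ r), fun r r' h => ?_, fun r hr S => ?_⟩
  · rintro _ ⟨a, rfl⟩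
    obtain ⟨b, hb⟩ := range_gabMap_mono g h ⟨a, rfl⟩
    refine ⟨b, ?_⟩
    ext v
    rw [hΦ, hΦ, hb]
  · have hinj : Function.Injective (Φ r) := by
      rw [← LinearMap.ker_eq_bot, eq_bot_iff]
      intro a ha
      refine eq_zero_of_gabMap_eq_zero hg (S := ⊤) (by rwa [finrank_top]) fun v _ => ?_
      have h := LinearMap.congr_fun (LinearMap.mem_ker.1 ha) v
      rw [hΦ] at h
      simpa using h
    have h1 : Nat.card (LinearMap.ker (gabMapOn g r S))
        = Nat.card F ^ (Module.finrank F W * (r - Module.finrank F S)) := by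
      rw [Module.natCard_eq_pow_finrank (K := K), finrank_ker_gabMapOn hg,
        Module.natCard_eq_pow_finrank (K := F) (V := K), hK, ← pow_mul]
    rw [← h1]
    have hmem : ∀ a, a ∈ LinearMap.ker (gabMapOn g r S) ↔ S ≤ LinearMap.ker (Φ r a) := by
      intro a
      rw [mem_ker_gabMapOn]
      refine forall₂_congr fun x _ => ?_
      rw [LinearMap.mem_ker, LinearMap.mem_ker, hΦ, LinearEquiv.map_eq_zero_iff]
    refine (Nat.card_congr (Equiv.ofBijective (fun a => ⟨Φ r a.1, ⟨a.1, rfl⟩, (hmem _).1 a.2⟩)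
      ⟨fun a b h => ?_, ?_⟩)).symm
    · exact Subtype.ext (hinj (congrArg Subtype.val h))
    · rintro ⟨_, ⟨a, rfl⟩, ha⟩
      exact ⟨⟨a, (hmem a).2 ha⟩, rfl⟩

/-- `f` has rank at least `d` for every nonzero `f` in `G`. -/
def MinRank (G : Submodule F (V →ₗ[F] W)) (d : ℕ) : Prop :=
  ∀ f ∈ G, f ≠ 0 → d ≤ Module.finrank F (LinearMap.range f)

/-- A map of smaller rank has a kernel of dimension at least `r`; only one codeword vanishes on such
a kernel, and the zero map already does. -/
theorem minRank_of_natCard {G : Submodule F (V →ₗ[F] W)} {m r : ℕ}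
    (hr : r ≤ Module.finrank F V)
    (hG : ∀ S : Submodule F V, Nat.card {f : V →ₗ[F] W // f ∈ G ∧ S ≤ LinearMap.ker f}
        = Nat.card F ^ (m * (r - Module.finrank F S))) :
    MinRank G (Module.finrank F V - r + 1) := by
  intro f hf hf0
  have h1 := LinearMap.finrank_range_add_finrank_ker f
  by_contra hlt
  have h2 := hG (LinearMap.ker f)
  rw [show r - Module.finrank F (LinearMap.ker f) = 0 by omega, mul_zero, pow_zero,
    Nat.card_eq_one_iff_unique] at h2
  have := h2.1
  exact hf0 (congrArg Subtype.val (Subsingleton.elim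
    (⟨f, hf, le_rfl⟩ : {g : V →ₗ[F] W // g ∈ G ∧ LinearMap.ker f ≤ LinearMap.ker g})
    ⟨0, G.zero_mem, by simp⟩))

theorem natCard_of_natCard {G : Submodule F (V →ₗ[F] W)} {m r : ℕ}
    (hG : ∀ S : Submodule F V, Nat.card {f : V →ₗ[F] W // f ∈ G ∧ S ≤ LinearMap.ker f}
        = Nat.card F ^ (m * (r - Module.finrank F S))) :
    Nat.card G = Nat.card F ^ (m * r) := by
  have h := hG ⊥
  rw [finrank_bot, Nat.sub_zero] at h
  rw [← h]
  exact Nat.card_congr (Equiv.subtypeEquivRight fun f => by simp)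

/-- Double counting of pairs of a codeword and an `s`-dimensional subspace of its kernel. -/
theorem sum_gaussBinom_finrank_ker {G : Submodule F (V →ₗ[F] W)} {m r : ℕ}
    (hG : ∀ S : Submodule F V, Nat.card {f : V →ₗ[F] W // f ∈ G ∧ S ≤ LinearMap.ker f}
        = Nat.card F ^ (m * (r - Module.finrank F S))) (s : ℕ) :
    ∑ v ∈ Finset.range (Module.finrank F V + 1),
        (Nat.card {f : V →ₗ[F] W // f ∈ G ∧ Module.finrank F (LinearMap.ker f) = v} : ℚ) *
          gaussBinom (Nat.card F) v s
      = gaussBinom (Nat.card F) (Module.finrank F V) s * (Nat.card F : ℚ) ^ (m * (r - s)) := by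
  classical
  have : Finite V := Module.finite_of_finite F
  have : Finite W := Module.finite_of_finite F
  have : Finite (V →ₗ[F] W) := Module.finite_of_finite F
  have : Fintype (V →ₗ[F] W) := Fintype.ofFinite _
  have : Fintype (Submodule F V) := Fintype.ofFinite _
  have h1 : ∑ f : V →ₗ[F] W with f ∈ G,
        ((Finset.univ.filter fun S : Submodule F V =>
          Module.finrank F S = s ∧ S ≤ LinearMap.ker f).card : ℚ)
      = ∑ S ∈ Finset.univ.filter fun S : Submodule F V => Module.finrank F S = s,
        ((Finset.univ.filter fun f : V →ₗ[F] W => f ∈ G ∧ S ≤ LinearMap.ker f).card : ℚ) := by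
    have := Finset.sum_card_bipartiteAbove_eq_sum_card_bipartiteBelow
      (s := Finset.univ.filter fun f : V →ₗ[F] W => f ∈ G)
      (t := (Finset.univ : Finset (Submodule F V)).filter fun S => Module.finrank F S = s)
      (fun (f : V →ₗ[F] W) (S : Submodule F V) => S ≤ LinearMap.ker f)
    simp only [Finset.bipartiteAbove, Finset.bipartiteBelow, Finset.filter_filter] at this
    exact_mod_cast this
  have h2 : ∀ f : V →ₗ[F] W, ((Finset.univ.filter fun S : Submodule F V =>
      Module.finrank F S = s ∧ S ≤ LinearMap.ker f).card : ℚ)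
      = gaussBinom (Nat.card F) (Module.finrank F (LinearMap.ker f)) s := by
    intro f
    rw [← natCard_subspaces_le, Nat.card_eq_fintype_card, Fintype.card_subtype]
  have h3 : ∀ S ∈ Finset.univ.filter fun S : Submodule F V => Module.finrank F S = s,
      ((Finset.univ.filter fun f : V →ₗ[F] W => f ∈ G ∧ S ≤ LinearMap.ker f).card : ℚ)
      = (Nat.card F : ℚ) ^ (m * (r - s)) := by
    intro S hS
    have := hG S
    rw [(Finset.mem_filter.1 hS).2, Nat.card_eq_fintype_card, Fintype.card_subtype] at this
    exact_mod_cast this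
  rw [Finset.sum_congr rfl h3, Finset.sum_const, ← Fintype.card_subtype,
    ← Nat.card_eq_fintype_card, nsmul_eq_mul, natCard_subspaces] at h1
  rw [← h1, Finset.sum_congr rfl fun f _ => h2 f,
    ← Finset.sum_fiberwise_of_maps_to (g := fun f : V →ₗ[F] W =>
      Module.finrank F (LinearMap.ker f)) (t := Finset.range (Module.finrank F V + 1))]
  · refine Finset.sum_congr rfl fun v _ => ?_
    rw [Finset.filter_filter, Finset.sum_congr rfl
      (g := fun _ => gaussBinom (Nat.card F) v s), Finset.sum_const, nsmul_eq_mul,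
      Nat.card_eq_fintype_card, Fintype.card_subtype]
    intro f hf
    rw [(Finset.mem_filter.1 hf).2.2]
  · intro f _
    exact Finset.mem_range.2 (Nat.lt_succ_of_le (Submodule.finrank_le _))

/-- The double count gives the `q`-binomial moments of the kernel dimensions; inversion recovers the
individual numbers. -/
theorem natCard_finrank_ker_eq {G : Submodule F (V →ₗ[F] W)} {m r : ℕ}
    (hG : ∀ S : Submodule F V, Nat.card {f : V →ₗ[F] W // f ∈ G ∧ S ≤ LinearMap.ker f}
        = Nat.card F ^ (m * (r - Module.finrank F S))) {w : ℕ} (hw : w ≤ Module.finrank F V) :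
    (Nat.card {f : V →ₗ[F] W // f ∈ G ∧ Module.finrank F (LinearMap.ker f) = w} : ℚ)
      = gaussBinom (Nat.card F) (Module.finrank F V) w *
        ∑ j ∈ Finset.range (Module.finrank F V - w + 1),
          (-1 : ℚ) ^ j * (Nat.card F : ℚ) ^ (j * (j - 1) / 2) *
            gaussBinom (Nat.card F) (Module.finrank F V - w) j *
              (Nat.card F : ℚ) ^ (m * (r - (w + j))) := by
  have hq : 1 < Nat.card F := Finite.one_lt_card
  rw [← gaussBinom_inversion hq _ (fun v => (Nat.card {f : V →ₗ[F] W //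
    f ∈ G ∧ Module.finrank F (LinearMap.ker f) = v} : ℚ)) hw, Finset.mul_sum]
  refine Finset.sum_congr rfl fun j hj => ?_
  rw [Finset.mem_range] at hj
  have h := gaussBinom_mul hq (by omega : w ≤ w + j) (by omega : w + j ≤ Module.finrank F V)
  rw [show w + j - w = j by omega] at h
  rw [sum_gaussBinom_finrank_ker hG]
  linear_combination ((-1 : ℚ) ^ j * (Nat.card F : ℚ) ^ (j * (j - 1) / 2) *
    (Nat.card F : ℚ) ^ (m * (r - (w + j)))) * h

/-- Delsarte's rank distribution. -/
theorem natCard_finrank_range_eq {G : Submodule F (V →ₗ[F] W)} {d i : ℕ} (hd : 1 ≤ d)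
    (hdi : d ≤ i) (hi : i ≤ Module.finrank F V)
    (hVW : Module.finrank F V ≤ Module.finrank F W)
    (hG : ∀ S : Submodule F V, Nat.card {f : V →ₗ[F] W // f ∈ G ∧ S ≤ LinearMap.ker f}
        = Nat.card F ^ (Module.finrank F W *
          (Module.finrank F V - d + 1 - Module.finrank F S))) :
    (Nat.card {f : V →ₗ[F] W // f ∈ G ∧ Module.finrank F (LinearMap.range f) = i} : ℚ)
      = rankDist (Nat.card F) (Module.finrank F V) (Module.finrank F W) d i := by
  have hq : 1 < Nat.card F := Finite.one_lt_card
  have h1 : Nat.card {f : V →ₗ[F] W // f ∈ G ∧ Module.finrank F (LinearMap.range f) = i}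
      = Nat.card {f : V →ₗ[F] W //
        f ∈ G ∧ Module.finrank F (LinearMap.ker f) = Module.finrank F V - i} := by
    refine Nat.card_congr (Equiv.subtypeEquivRight fun f => and_congr_right fun _ => ?_)
    have := LinearMap.finrank_range_add_finrank_ker f
    omega
  rw [h1, natCard_finrank_ker_eq hG (Nat.sub_le _ _), gaussBinom_symm hq hi,
    Nat.sub_sub_self hi, rankDist, min_eq_left hVW, max_eq_right hVW]
  congr 1
  -- Subtracting this vanishing sum produces the `- 1` in Delsarte's formula and cancels the terms
  -- with `j > i - d`, whose truncated exponent is zero.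
  have h0 := sum_alternating_gaussBinom hq (by omega : i ≠ 0)
  rw [← sub_zero (∑ j ∈ Finset.range (i + 1), _), ← h0, ← Finset.sum_sub_distrib,
    ← Finset.sum_subset (Finset.range_mono (by omega : i - d + 1 ≤ i + 1))]
  · refine Finset.sum_congr rfl fun j hj => ?_
    rw [Finset.mem_range] at hj
    rw [show Module.finrank F V - d + 1 - (Module.finrank F V - i + j) = i - d - j + 1 by omega]
    ring
  · intro j _ hj
    rw [Finset.mem_range, not_lt] at hj
    rw [show Module.finrank F V - d + 1 - (Module.finrank F V - i + j) = 0 by omega, mul_zero,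
      pow_zero, mul_one, sub_self]

/-- The summand `1` is the zero map; every other codeword counted has rank between `d` and `r`. -/
theorem natCard_finrank_range_le {G : Submodule F (V →ₗ[F] W)} {d r : ℕ} (hd : 1 ≤ d)
    (hdV : d ≤ Module.finrank F V) (hr : r ≤ Module.finrank F V)
    (hVW : Module.finrank F V ≤ Module.finrank F W)
    (hG : ∀ S : Submodule F V, Nat.card {f : V →ₗ[F] W // f ∈ G ∧ S ≤ LinearMap.ker f}
        = Nat.card F ^ (Module.finrank F W *
          (Module.finrank F V - d + 1 - Module.finrank F S))) :
    (Nat.card {f : V →ₗ[F] W // f ∈ G ∧ Module.finrank F (LinearMap.range f) ≤ r} : ℚ)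
      = mrdSizeRestr (Nat.card F) (Module.finrank F V) (Module.finrank F W) d r := by
  classical
  have : Finite V := Module.finite_of_finite F
  have : Finite W := Module.finite_of_finite F
  have : Finite (V →ₗ[F] W) := Module.finite_of_finite F
  have : Fintype (V →ₗ[F] W) := Fintype.ofFinite _
  have hmin := minRank_of_natCard (by omega : Module.finrank F V - d + 1 ≤ _) hG
  rw [show Module.finrank F V - (Module.finrank F V - d + 1) + 1 = d by omega] at hmin
  have hrange0 : Module.finrank F (LinearMap.range (0 : V →ₗ[F] W)) = 0 := by
    rw [LinearMap.range_zero, finrank_bot]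
  have h0 : (Finset.univ.filter fun f : V →ₗ[F] W =>
      f ∈ G ∧ Module.finrank F (LinearMap.range f) ≤ r)
      = insert 0 (Finset.univ.filter fun f : V →ₗ[F] W =>
        f ∈ G ∧ f ≠ 0 ∧ Module.finrank F (LinearMap.range f) ≤ r) := by
    ext f
    by_cases hf : f = 0 <;> simp [hf, hrange0]
  rw [Nat.card_eq_fintype_card, Fintype.card_subtype, h0, Finset.card_insert_of_notMem (by simp),
    Finset.card_eq_sum_card_fiberwise (f := fun f : V →ₗ[F] W =>
      Module.finrank F (LinearMap.range f)) (t := Finset.Icc d r), mrdSizeRestr]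
  · push_cast
    rw [add_comm]
    congr 1
    refine Finset.sum_congr rfl fun i hi => ?_
    rw [Finset.mem_Icc] at hi
    rw [← natCard_finrank_range_eq hd hi.1 (hi.2.trans hr) hVW hG, Nat.card_eq_fintype_card,
      Fintype.card_subtype, Finset.filter_filter]
    congr 2
    ext f
    simp only [Finset.mem_filter, Finset.mem_univ, true_and]
    constructor
    · rintro ⟨⟨h1, _, _⟩, h2⟩
      exact ⟨h1, h2⟩
    · rintro ⟨h1, h2⟩
      refine ⟨⟨h1, ?_, h2 ▸ hi.2⟩, h2⟩
      rintro rfl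
      omega
  · intro f hf
    simp only [Finset.coe_filter, Finset.mem_univ, true_and, Set.mem_ofPred_eq] at hf
    exact Finset.mem_coe.2 (Finset.mem_Icc.2 ⟨hmin f hf.1 hf.2.1, hf.2.2⟩)

end MRD

/-! ### Nested MRD codes and codes of pairs of maps. -/

section MRDChain

variable {F V W V' W' : Type*} [Field F] [Finite F]
  [AddCommGroup V] [Module F V] [FiniteDimensional F V]
  [AddCommGroup W] [Module F W] [FiniteDimensional F W]
  [AddCommGroup V'] [Module F V'] [FiniteDimensional F V']
  [AddCommGroup W'] [Module F W'] [FiniteDimensional F W']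

/-- Linear MRD codes with known restricted rank distribution, for `dim V ≤ dim W`. -/
theorem exists_mrd_of_le {d : ℕ} (hd : 1 ≤ d) (hdV : d ≤ Module.finrank F V)
    (hVW : Module.finrank F V ≤ Module.finrank F W) :
    ∃ G : Submodule F (V →ₗ[F] W), MinRank G d ∧
      Nat.card G = mrdSize (Nat.card F) (Module.finrank F V) (Module.finrank F W) d ∧
      ∀ r ≤ Module.finrank F V,
        (Nat.card {f : V →ₗ[F] W // f ∈ G ∧ Module.finrank F (LinearMap.range f) ≤ r} : ℚ)
          = mrdSizeRestr (Nat.card F) (Module.finrank F V) (Module.finrank F W) d r := by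
  obtain ⟨G, -, hG⟩ := exists_gabidulin hVW (by omega)
  have h := hG (Module.finrank F V - d + 1) (by omega)
  refine ⟨G (Module.finrank F V - d + 1), ?_, ?_, fun r hr =>
    natCard_finrank_range_le hd hdV hr hVW h⟩
  · have := minRank_of_natCard (by omega) h
    rwa [show Module.finrank F V - (Module.finrank F V - d + 1) + 1 = d by omega] at this
  · rw [natCard_of_natCard h, mrdSize, min_eq_left hVW, max_eq_right hVW]

theorem exists_mrd_chain_of_le (hVW : Module.finrank F V ≤ Module.finrank F W)
    (hW : 0 < Module.finrank F W) :
    ∃ G : ℕ → Submodule F (V →ₗ[F] W), Antitone G ∧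
      ∀ d, 1 ≤ d → d ≤ Module.finrank F V → MinRank (G d) d ∧
        Nat.card (G d) = mrdSize (Nat.card F) (Module.finrank F V) (Module.finrank F W) d := by
  obtain ⟨G, hmono, hG⟩ := exists_gabidulin hVW hW
  -- Larger minimum rank means fewer coefficients, so the monotone chain becomes antitone in `d`.
  refine ⟨fun d => G (Module.finrank F V - d + 1), fun d d' h => hmono (by omega),
    fun d hd hdV => ?_⟩
  have h := hG (Module.finrank F V - d + 1) (by omega)
  refine ⟨?_, ?_⟩
  · have := minRank_of_natCard (by omega) h
    rwa [show Module.finrank F V - (Module.finrank F V - d + 1) + 1 = d by omega] at this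
  · rw [natCard_of_natCard h, mrdSize, min_eq_left hVW, max_eq_right hVW]

theorem transpose_bijective :
    Function.Bijective (Module.Dual.transpose (R := F) (M := V) (M' := W)) := by
  have hinj : Function.Injective (Module.Dual.transpose (R := F) (M := V) (M' := W)) := by
    intro f g h
    ext v
    rw [← sub_eq_zero, ← Module.forall_dual_apply_eq_zero_iff F]
    intro φ
    have h1 := LinearMap.congr_fun (LinearMap.congr_fun h φ) v
    rw [map_sub, sub_eq_zero]
    exact h1
  have hdim : Module.finrank F (V →ₗ[F] W)
      = Module.finrank F (Module.Dual F W →ₗ[F] Module.Dual F V) := by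
    rw [Module.finrank_linearMap, Module.finrank_linearMap, Subspace.dual_finrank_eq,
      Subspace.dual_finrank_eq, mul_comm]
  refine ⟨hinj, ?_⟩
  have := LinearMap.injective_iff_surjective_of_finrank_eq_finrank (K := F)
    (V := V →ₗ[F] W) (V₂ := Module.Dual F W →ₗ[F] Module.Dual F V) hdim
    (f := Module.Dual.transpose (R := F) (M := V) (M' := W))
  exact this.1 hinj

/-- Transposition is a rank-preserving linear bijection, so the case `dim W ≤ dim V` follows by
passing to duals. -/
theorem exists_mrd_chain (hV : 0 < Module.finrank F V) (hW : 0 < Module.finrank F W) :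
    ∃ G : ℕ → Submodule F (V →ₗ[F] W), Antitone G ∧
      ∀ d, 1 ≤ d → d ≤ min (Module.finrank F V) (Module.finrank F W) → MinRank (G d) d ∧
        Nat.card (G d) = mrdSize (Nat.card F) (Module.finrank F V) (Module.finrank F W) d := by
  rcases le_total (Module.finrank F V) (Module.finrank F W) with h | h
  · rw [min_eq_left h]
    exact exists_mrd_chain_of_le h hW
  · have hW' : Module.finrank F (Module.Dual F W) = Module.finrank F W := Subspace.dual_finrank_eq
    have hV' : Module.finrank F (Module.Dual F V) = Module.finrank F V := Subspace.dual_finrank_eq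
    obtain ⟨G, hanti, hG⟩ := exists_mrd_chain_of_le (F := F) (V := Module.Dual F W)
      (W := Module.Dual F V) (by omega) (by omega)
    rw [hW', hV'] at hG
    have hbij := transpose_bijective (F := F) (V := V) (W := W)
    refine ⟨fun d => (G d).comap Module.Dual.transpose, fun d d' hd =>
      Submodule.comap_mono (hanti hd), fun d hd hdW => ?_⟩
    rw [min_eq_right h] at hdW
    obtain ⟨h1, h2⟩ := hG d hd hdW
    refine ⟨fun f hf hf0 => ?_, ?_⟩
    · have h3 := h1 _ hf fun h0 => hf0 (hbij.1 (h0.trans (map_zero _).symm))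
      rwa [show Module.Dual.transpose f = f.dualMap from rfl,
        LinearMap.finrank_range_dualMap_eq_finrank_range] at h3
    · rw [mrdSize, max_comm, min_comm, ← mrdSize, ← h2]
      refine Nat.card_congr (Equiv.ofBijective (fun f => ⟨Module.Dual.transpose f.1, f.2⟩)
        ⟨fun f g h => Subtype.ext (hbij.1 (congrArg Subtype.val h)), ?_⟩)
      rintro ⟨g, hg⟩
      obtain ⟨f, rfl⟩ := hbij.2 g
      exact ⟨⟨f, hg⟩, rfl⟩

/-- If `A ≤ B`, any space of dimension at most `dim B - dim A` embeds into `B` disjointly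
from `A`. -/
theorem exists_injective_disjoint {A B : Submodule F V} (hAB : A ≤ B) {e : ℕ}
    (he : Module.finrank F A + e ≤ Module.finrank F B) :
    ∃ φ : (Fin e → F) →ₗ[F] V, (∀ x, φ x ∈ B) ∧ ∀ x, φ x ∈ A → x = 0 := by
  obtain ⟨H, hH⟩ := Submodule.exists_isCompl A
  have h1 : A ⊔ H ⊓ B = B := by
    rw [← sup_inf_assoc_of_le H hAB, hH.sup_eq_top, top_inf_eq]
  have h2 : A ⊓ (H ⊓ B) = ⊥ := by
    rw [← inf_assoc, hH.inf_eq_bot, bot_inf_eq]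
  have h3 := Submodule.finrank_sup_add_finrank_inf_eq A (H ⊓ B)
  rw [h1, h2, finrank_bot] at h3
  obtain ⟨φ, hφ⟩ := (finrank_le_iff_exists_linearMap (R := F) (M := Fin e → F)
    (M' := (H ⊓ B : Submodule F V))).1 (by rw [Module.finrank_fin_fun]; omega)
  refine ⟨(H ⊓ B).subtype ∘ₗ φ, fun x => (φ x).2.2, fun x hx => ?_⟩
  have h4 : ((φ x : V)) ∈ A ⊓ (H ⊓ B) := ⟨hx, (φ x).2⟩
  rw [h2, Submodule.mem_bot] at h4
  exact hφ (by rw [map_zero]; exact Subtype.ext h4)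

theorem finrank_eq_of_natCard {S : Submodule F V} {m : ℕ} (h : Nat.card S = Nat.card F ^ m) :
    Module.finrank F S = m := by
  rw [Module.natCard_eq_pow_finrank (K := F)] at h
  exact Nat.pow_right_injective (Finite.one_lt_card : 1 < Nat.card F) h

/-- A linear code of pairs of maps in which every nonzero pair has total rank at least `d₁ + d₂`,
obtained by combining two pairs of nested MRD codes. -/
theorem exists_pair_code {d₁ d₂ : ℕ} (hd₁ : 1 ≤ d₁) (hd₂ : 1 ≤ d₂)
    (hVW : d₁ + d₂ ≤ min (Module.finrank F V) (Module.finrank F W))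
    (hVW' : d₁ + d₂ ≤ min (Module.finrank F V') (Module.finrank F W')) :
    ∃ S : Submodule F ((V →ₗ[F] W) × (V' →ₗ[F] W')),
      (∀ s ∈ S, s ≠ 0 → d₁ + d₂ ≤
        Module.finrank F (LinearMap.range s.1) + Module.finrank F (LinearMap.range s.2)) ∧
      Nat.card S = Nat.card F ^
        (min (max (Module.finrank F V) (Module.finrank F W) * d₂)
            (max (Module.finrank F V') (Module.finrank F W') * d₁)
          + max (Module.finrank F V) (Module.finrank F W) *
              (min (Module.finrank F V) (Module.finrank F W) - (d₁ + d₂) + 1)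
          + max (Module.finrank F V') (Module.finrank F W') *
              (min (Module.finrank F V') (Module.finrank F W') - (d₁ + d₂) + 1)) := by
  obtain ⟨G, hGa, hG⟩ := exists_mrd_chain (F := F) (V := V) (W := W) (by omega) (by omega)
  obtain ⟨G', hGa', hG'⟩ := exists_mrd_chain (F := F) (V := V') (W := W') (by omega) (by omega)
  simp only [mrdSize] at hG hG'
  generalize min (Module.finrank F V) (Module.finrank F W) = l at *
  generalize max (Module.finrank F V) (Module.finrank F W) = m at *
  generalize min (Module.finrank F V') (Module.finrank F W') = l' at *
  generalize max (Module.finrank F V') (Module.finrank F W') = m' at *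
  -- The quotients `G d₁ / G (d₁ + d₂)` and `G' d₂ / G' (d₁ + d₂)` have dimensions `m * d₂` and `m'
  -- * d₁`, so `F ^ e` embeds in a complement on both sides.
  set e := min (m * d₂) (m' * d₁) with he
  have key : ∀ {a b c x : ℕ}, x ≤ c * b → a + b ≤ l → c * (l - (a + b) + 1) + x
      ≤ c * (l - a + 1) := by
    intro a b c x hx hab
    rw [show l - a + 1 = (l - (a + b) + 1) + b by omega, Nat.mul_add c (l - (a + b) + 1) b]
    omega
  have key' : ∀ {a b c x : ℕ}, x ≤ c * a → a + b ≤ l' → c * (l' - (a + b) + 1) + x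
      ≤ c * (l' - b + 1) := by
    intro a b c x hx hab
    rw [show l' - b + 1 = (l' - (a + b) + 1) + a by omega, Nat.mul_add c (l' - (a + b) + 1) a]
    omega
  obtain ⟨φ, hφ, hφ0⟩ := exists_injective_disjoint (hGa (Nat.le_add_right d₁ d₂)) (e := e) (by
    rw [finrank_eq_of_natCard (hG (d₁ + d₂) (by omega) hVW).2,
      finrank_eq_of_natCard (hG d₁ hd₁ (by omega)).2]
    exact key (min_le_left _ _) hVW)
  obtain ⟨ψ, hψ, hψ0⟩ := exists_injective_disjoint (hGa' (Nat.le_add_left d₂ d₁)) (e := e) (by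
    rw [finrank_eq_of_natCard (hG' (d₁ + d₂) (by omega) hVW').2,
      finrank_eq_of_natCard (hG' d₂ hd₂ (by omega)).2]
    exact key' (min_le_right _ _) hVW')
  let T : ((G (d₁ + d₂) × G' (d₁ + d₂)) × (Fin e → F)) →ₗ[F] ((V →ₗ[F] W) × (V' →ₗ[F] W')) :=
    (LinearMap.prodMap (G (d₁ + d₂)).subtype (G' (d₁ + d₂)).subtype).coprod (φ.prod ψ)
  have hT : ∀ a b x, T ((a, b), x) = ((a : V →ₗ[F] W) + φ x, (b : V' →ₗ[F] W') + ψ x) :=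
    fun a b x => rfl
  have hTinj : Function.Injective T := by
    rw [← LinearMap.ker_eq_bot, eq_bot_iff]
    rintro ⟨⟨a, b⟩, x⟩ h
    rw [LinearMap.mem_ker, hT, Prod.mk_eq_zero] at h
    have hx : x = 0 := hφ0 x (by
      rw [← neg_eq_of_add_eq_zero_right h.1]
      exact Submodule.neg_mem _ a.2)
    subst hx
    rw [map_zero, map_zero, add_zero, add_zero] at h
    rw [Submodule.mem_bot]
    exact Prod.ext (Prod.ext (Subtype.ext h.1) (Subtype.ext h.2)) rfl
  refine ⟨LinearMap.range T, ?_, ?_⟩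
  · rintro _ ⟨⟨⟨a, b⟩, x⟩, rfl⟩ h0
    rw [hT] at h0 ⊢
    -- Without glue, a nonzero component alone has rank at least `d₁ + d₂`. With `x ≠ 0` both
    -- components are nonzero, in `G d₁` and `G' d₂`, and their ranks add up.
    by_cases hx : x = 0
    · subst hx
      rw [map_zero, map_zero, add_zero, add_zero] at h0 ⊢
      by_cases ha : (a : V →ₗ[F] W) = 0
      · have hb : (b : V' →ₗ[F] W') ≠ 0 := fun hb => h0 (Prod.ext ha hb)
        exact ((hG' (d₁ + d₂) (by omega) hVW').1 b b.2 hb).trans (Nat.le_add_left _ _)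
      · exact ((hG (d₁ + d₂) (by omega) hVW).1 a a.2 ha).trans (Nat.le_add_right _ _)
    · refine Nat.add_le_add ((hG d₁ hd₁ (by omega)).1 _ ?_ fun h => hx (hφ0 x ?_))
        ((hG' d₂ hd₂ (by omega)).1 _ ?_ fun h => hx (hψ0 x ?_))
      · exact Submodule.add_mem _ (hGa (Nat.le_add_right d₁ d₂) a.2) (hφ x)
      · rw [← neg_eq_of_add_eq_zero_right h]
        exact Submodule.neg_mem _ a.2
      · exact Submodule.add_mem _ (hGa' (Nat.le_add_left d₂ d₁) b.2) (hψ x)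
      · rw [← neg_eq_of_add_eq_zero_right h]
        exact Submodule.neg_mem _ b.2
  · rw [Nat.card_congr (LinearEquiv.ofInjective T hTinj).symm.toEquiv, Nat.card_prod,
      Nat.card_prod, (hG (d₁ + d₂) (by omega) hVW).2, (hG' (d₁ + d₂) (by omega) hVW').2,
      Module.natCard_eq_pow_finrank (K := F) (V := Fin e → F), Module.finrank_fin_fun,
      ← pow_add, ← pow_add]
    congr 1
    ring

end MRDChain

/-! ### Intersection bounds for subspaces and graphs. -/

section DimensionBounds

variable {F E E' D Q : Type*} [Field F] [AddCommGroup E] [Module F E] [FiniteDimensional F E]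
  [AddCommGroup E'] [Module F E'] [FiniteDimensional F E']
  [AddCommGroup D] [Module F D] [FiniteDimensional F D]
  [AddCommGroup Q] [Module F Q] [FiniteDimensional F Q]

theorem finrank_map_add_finrank_inf_ker (Z : Submodule F E) (f : E →ₗ[F] E') :
    Module.finrank F (Z.map f) + Module.finrank F (Z ⊓ LinearMap.ker f : Submodule F E)
      = Module.finrank F Z := by
  rw [← LinearMap.finrank_range_add_finrank_ker (f.domRestrict Z), LinearMap.range_domRestrict,
    LinearMap.ker_domRestrict, ← Submodule.finrank_map_subtype_eq, Submodule.map_comap_subtype]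

/-- `Z₁ ⊓ Z₂` and `Z₂ ⊓ ker f` are independent inside `Z₂`. This single bound handles every
comparison between different families. -/
theorem finrank_inf_add_le_of_ker {Z₁ Z₂ : Submodule F E} {f : E →ₗ[F] E'} {δ : ℕ}
    (h₁ : Z₁ ⊓ LinearMap.ker f = ⊥)
    (h₂ : δ ≤ Module.finrank F (Z₂ ⊓ LinearMap.ker f : Submodule F E)) :
    Module.finrank F (Z₁ ⊓ Z₂ : Submodule F E) + δ ≤ Module.finrank F Z₂ := by
  have h := Submodule.finrank_sup_add_finrank_inf_eq (Z₁ ⊓ Z₂) (Z₂ ⊓ LinearMap.ker f)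
  have h0 : (Z₁ ⊓ Z₂) ⊓ (Z₂ ⊓ LinearMap.ker f) = ⊥ := by
    rw [eq_bot_iff, ← h₁]
    exact le_inf (inf_le_left.trans inf_le_left) (inf_le_right.trans inf_le_right)
  rw [h0, finrank_bot] at h
  have h3 : Module.finrank F ((Z₁ ⊓ Z₂) ⊔ (Z₂ ⊓ LinearMap.ker f) : Submodule F E)
      ≤ Module.finrank F Z₂ := Submodule.finrank_mono (sup_le inf_le_right inf_le_left)
  omega

theorem le_finrank_of_injective {Z : Submodule F E} (h : D →ₗ[F] E) (hinj : Function.Injective h)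
    (hZ : ∀ x, h x ∈ Z) : Module.finrank F D ≤ Module.finrank F Z := by
  rw [← LinearMap.finrank_range_of_inj hinj]
  exact Submodule.finrank_mono (by rintro _ ⟨x, rfl⟩; exact hZ x)

theorem finrank_le_of_exists {Z : Submodule F E} (h : D →ₗ[F] E) (hZ : ∀ z ∈ Z, ∃ x, h x = z) :
    Module.finrank F Z ≤ Module.finrank F D :=
  (Submodule.finrank_mono (fun z hz => hZ z hz : Z ≤ LinearMap.range h)).trans
    (LinearMap.finrank_range_le h)

/-- The image under `e` of the graph of `M`. -/
def graphCode (e : D × Q →ₗ[F] E) (M : D →ₗ[F] Q) : Submodule F E :=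
  LinearMap.range (e ∘ₗ LinearMap.id.prod M)

theorem finrank_graphCode {e : D × Q →ₗ[F] E} (he : Function.Injective e) (M : D →ₗ[F] Q) :
    Module.finrank F (graphCode e M) = Module.finrank F D :=
  LinearMap.finrank_range_of_inj fun _ _ h => congrArg Prod.fst (he h)

/-- A common vector of two graphs comes from one `x` with `M x = M' x`, so the intersection is
covered by the kernel of the difference. -/
theorem finrank_graphCode_inf {e : D × Q →ₗ[F] E} (he : Function.Injective e) (M M' : D →ₗ[F] Q) :
    Module.finrank F (graphCode e M ⊓ graphCode e M' : Submodule F E)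
      + Module.finrank F (LinearMap.range (M - M')) ≤ Module.finrank F D := by
  rw [← LinearMap.finrank_range_add_finrank_ker (M - M'), add_comm]
  refine Nat.add_le_add_left ?_ _
  refine finrank_le_of_exists ((e ∘ₗ LinearMap.id.prod M) ∘ₗ (LinearMap.ker (M - M')).subtype) ?_
  rintro _ ⟨⟨x, rfl⟩, ⟨y, hy⟩⟩
  have h := he hy
  have h1 : y = x := congrArg Prod.fst h
  have h2 : M' y = M x := congrArg Prod.snd h
  refine ⟨⟨x, ?_⟩, rfl⟩
  rw [LinearMap.mem_ker, LinearMap.sub_apply, ← h2, h1, sub_self]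

end DimensionBounds

/-! ### Coordinate blocks of vectors. -/

section Blocks

variable {F : Type*} [Field F]

/-- Insertion of a block of length `b` at position `o` into a vector of length `n`. -/
def blockIns (n o b : ℕ) : (Fin b → F) →ₗ[F] (Fin n → F) where
  toFun x m := if h : o ≤ (m : ℕ) ∧ (m : ℕ) - o < b then x ⟨m - o, h.2⟩ else 0
  map_add' x y := by
    ext m
    by_cases h : o ≤ (m : ℕ) ∧ (m : ℕ) - o < b <;> simp [h]
  map_smul' c x := by
    ext m
    by_cases h : o ≤ (m : ℕ) ∧ (m : ℕ) - o < b <;> simp [h]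

/-- The block of length `b` at position `o` of a vector of length `n`. -/
def blockProj (n o b : ℕ) : (Fin n → F) →ₗ[F] (Fin b → F) where
  toFun v x := if h : o + (x : ℕ) < n then v ⟨o + x, h⟩ else 0
  map_add' v w := by
    ext x
    by_cases h : o + (x : ℕ) < n <;> simp [h]
  map_smul' c v := by
    ext x
    by_cases h : o + (x : ℕ) < n <;> simp [h]

theorem blockIns_apply (n o b : ℕ) (x : Fin b → F) (m : Fin n) :
    blockIns n o b x m = if h : o ≤ (m : ℕ) ∧ (m : ℕ) - o < b then x ⟨m - o, h.2⟩ else 0 := rfl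

theorem blockProj_apply (n o b : ℕ) (v : Fin n → F) (x : Fin b) :
    blockProj n o b v x = if h : o + (x : ℕ) < n then v ⟨o + x, h⟩ else 0 := rfl

theorem blockProj_blockIns_self {n o b : ℕ} (h : o + b ≤ n) (x : Fin b → F) :
    blockProj n o b (blockIns n o b x) = x := by
  ext m
  have hm := m.2
  rw [blockProj_apply, dif_pos (by omega), blockIns_apply, dif_pos (by simp)]
  congr 1
  ext
  simp

theorem blockProj_blockIns_disjoint (n : ℕ) {o b o' b' : ℕ} (h : o + b ≤ o' ∨ o' + b' ≤ o)
    (x : Fin b' → F) : blockProj n o b (blockIns n o' b' x) = 0 := by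
  ext m
  have hm := m.2
  rw [blockProj_apply]
  split_ifs with h1
  · rw [blockIns_apply, dif_neg]
    · rfl
    · simp only
      omega
  · rfl

theorem blockProj_eq_zero_of_le {n o b o' b' : ℕ} {v : Fin n → F} (h : blockProj n o b v = 0)
    (ho : o ≤ o') (hb : o' + b' ≤ o + b) : blockProj n o' b' v = 0 := by
  ext m
  have hm := m.2
  rw [blockProj_apply]
  split_ifs with h1
  · have h2 := congrFun h ⟨o' + m - o, by omega⟩
    rw [blockProj_apply, dif_pos (by simp only; omega)] at h2
    rw [Pi.zero_apply, ← Pi.zero_apply (M := fun _ : Fin b => F) ⟨o' + m - o, by omega⟩, ← h2]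
    congr 1
    ext
    simp only
    omega
  · rfl

theorem blockIns_blockIns (n o : ℕ) {b b' : ℕ} (h : b' ≤ b) (x : Fin b' → F) :
    blockIns n o b (blockIns b 0 b' x) = blockIns n o b' x := by
  ext m
  simp only [blockIns_apply]
  split_ifs with h1 h2 h2 h2
  all_goals first | rfl | (exfalso; omega)

end Blocks

/-! ### First family: lifted codewords of the mixed dimension/distance code. -/

section LiftedFamily

variable {F : Type*} [Field F] {n n₁ c m c' m' : ℕ} {U U' : Submodule F (Fin n₁ → F)}

variable (n c m U) in
/-- The embedding `((u, p), z) ↦ (u | p | z)`, padded by zeros to length `n`. -/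
def liftEmb : (U × (Fin c → F)) × (Fin m → F) →ₗ[F] (Fin n → F) :=
  ((blockIns n 0 n₁ ∘ₗ U.subtype).coprod (blockIns n n₁ c)).coprod (blockIns n (n₁ + c) m)

theorem liftEmb_apply (u : U) (p : Fin c → F) (z : Fin m → F) :
    liftEmb n c m U ((u, p), z)
      = blockIns n 0 n₁ u + blockIns n n₁ c p + blockIns n (n₁ + c) m z := rfl

theorem blockProj_liftEmb_left (h : n₁ + c + m ≤ n) (u : U) (p : Fin c → F) (z : Fin m → F) :
    blockProj n 0 n₁ (liftEmb n c m U ((u, p), z)) = u := by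
  rw [liftEmb_apply, map_add, map_add, blockProj_blockIns_self (by omega),
    blockProj_blockIns_disjoint n (by omega), blockProj_blockIns_disjoint n (by omega), add_zero,
    add_zero]

theorem blockProj_liftEmb_middle (h : n₁ + c + m ≤ n) (u : U) (p : Fin c → F) (z : Fin m → F) :
    blockProj n n₁ c (liftEmb n c m U ((u, p), z)) = p := by
  rw [liftEmb_apply, map_add, map_add, blockProj_blockIns_self (by omega),
    blockProj_blockIns_disjoint n (by omega), blockProj_blockIns_disjoint n (by omega), add_zero,
    zero_add]

theorem blockProj_liftEmb_right (h : n₁ + c + m ≤ n) (u : U) (p : Fin c → F) (z : Fin m → F) :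
    blockProj n (n₁ + c) m (liftEmb n c m U ((u, p), z)) = z := by
  rw [liftEmb_apply, map_add, map_add, blockProj_blockIns_self (by omega),
    blockProj_blockIns_disjoint n (by omega), blockProj_blockIns_disjoint n (by omega), add_zero,
    zero_add]

theorem liftEmb_injective (h : n₁ + c + m ≤ n) : Function.Injective (liftEmb n c m U) := by
  rintro ⟨⟨u, p⟩, z⟩ ⟨⟨u', p'⟩, z'⟩ he
  have h1 := congrArg (blockProj n 0 n₁) he
  have h2 := congrArg (blockProj n n₁ c) he
  have h3 := congrArg (blockProj n (n₁ + c) m) he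
  rw [blockProj_liftEmb_left h, blockProj_liftEmb_left h] at h1
  rw [blockProj_liftEmb_middle h, blockProj_liftEmb_middle h] at h2
  rw [blockProj_liftEmb_right h, blockProj_liftEmb_right h] at h3
  rw [Subtype.ext h1, h2, h3]

variable (n U) in
/-- The subspace `{(u | p | M (u, p))}` of `F ^ n`. -/
def liftCode (M : U × (Fin c → F) →ₗ[F] (Fin m → F)) : Submodule F (Fin n → F) :=
  graphCode (liftEmb n c m U) M

theorem finrank_liftCode (h : n₁ + c + m ≤ n) (M : U × (Fin c → F) →ₗ[F] (Fin m → F)) :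
    Module.finrank F (liftCode n U M) = Module.finrank F U + c := by
  have h1 := finrank_graphCode (D := U × (Fin c → F)) (Q := Fin m → F)
    (e := liftEmb n c m U) (liftEmb_injective h) M
  rwa [Module.finrank_prod, Module.finrank_fin_fun] at h1

theorem finrank_liftCode_inf (h : n₁ + c + m ≤ n) (M M' : U × (Fin c → F) →ₗ[F] (Fin m → F)) :
    Module.finrank F (liftCode n U M ⊓ liftCode n U M' : Submodule F (Fin n → F))
      + Module.finrank F (LinearMap.range (M - M')) ≤ Module.finrank F U + c := by
  have h1 := finrank_graphCode_inf (D := U × (Fin c → F)) (Q := Fin m → F)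
    (e := liftEmb n c m U) (liftEmb_injective h) M M'
  rwa [Module.finrank_prod, Module.finrank_fin_fun] at h1

/-- The first `n₁ + c` coordinates are `(u | p)`, which determine the vector. -/
theorem liftCode_inf_ker (h : n₁ + c + m ≤ n) (M : U × (Fin c → F) →ₗ[F] (Fin m → F))
    {b : ℕ} (hb : n₁ + c ≤ b) :
    liftCode n U M ⊓ LinearMap.ker (blockProj n 0 b) = ⊥ := by
  rw [eq_bot_iff]
  rintro _ ⟨⟨⟨u, p⟩, rfl⟩, hv⟩
  have hv : blockProj n 0 b (liftEmb n c m U ((u, p), M (u, p))) = 0 := hv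
  have h1 := blockProj_eq_zero_of_le hv (o' := 0) (b' := n₁) le_rfl (by omega)
  have h2 := blockProj_eq_zero_of_le hv (o' := n₁) (b' := c) (by omega) (by omega)
  rw [blockProj_liftEmb_left h] at h1
  rw [blockProj_liftEmb_middle h] at h2
  have h3 : (u, p) = 0 := Prod.ext (Subtype.ext h1) h2
  rw [h3, map_zero]
  exact Submodule.zero_mem _

theorem finrank_liftCode_inf_ker_le (h : n₁ + c + m ≤ n)
    (M : U × (Fin c → F) →ₗ[F] (Fin m → F)) :
    Module.finrank F
      (liftCode n U M ⊓ LinearMap.ker (blockProj n 0 n₁) :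
        Submodule F (Fin n → F)) ≤ c := by
  conv_rhs => rw [← Module.finrank_fin_fun F (n := c)]
  refine finrank_le_of_exists
    ((liftEmb n c m U ∘ₗ LinearMap.id.prod M) ∘ₗ LinearMap.inr F U (Fin c → F)) ?_
  rintro _ ⟨⟨⟨u, p⟩, rfl⟩, hv⟩
  have hv : blockProj n 0 n₁ (liftEmb n c m U ((u, p), M (u, p))) = 0 := hv
  rw [blockProj_liftEmb_left h] at hv
  have hu : u = 0 := Subtype.ext hv
  subst hu
  exact ⟨p, rfl⟩

/-- Projection to the first `n₁` coordinates sends the intersection into `U ⊓ U'`; what it kills has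
`u = 0` and is parametrised by `p` on either side. -/
theorem finrank_liftCode_inf_le (h : n₁ + c + m ≤ n) (h' : n₁ + c' + m' ≤ n)
    (M : U × (Fin c → F) →ₗ[F] (Fin m → F)) (M' : U' × (Fin c' → F) →ₗ[F] (Fin m' → F)) :
    Module.finrank F
      (liftCode n U M ⊓ liftCode n U' M' :
        Submodule F (Fin n → F))
        ≤ Module.finrank F (U ⊓ U' : Submodule F (Fin n₁ → F)) + min c c' := by
  rw [← finrank_map_add_finrank_inf_ker _ (blockProj n 0 n₁)]
  refine Nat.add_le_add (Submodule.finrank_mono ?_) (le_min ?_ ?_)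
  · rintro _ ⟨v, ⟨⟨⟨u, p⟩, hu⟩, ⟨⟨u', p'⟩, hu'⟩⟩, rfl⟩
    refine ⟨?_, ?_⟩
    · rw [← hu]
      change blockProj n 0 n₁ (liftEmb n c m U ((u, p), M (u, p))) ∈ U
      rw [blockProj_liftEmb_left h]
      exact u.2
    · rw [← hu']
      change blockProj n 0 n₁ (liftEmb n c' m' U' ((u', p'), M' (u', p'))) ∈ U'
      rw [blockProj_liftEmb_left h']
      exact u'.2
  · exact (Submodule.finrank_mono (inf_le_inf_right _ inf_le_left)).trans
      (finrank_liftCode_inf_ker_le h M)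
  · exact (Submodule.finrank_mono (inf_le_inf_right _ inf_le_right)).trans
      (finrank_liftCode_inf_ker_le h' M')

end LiftedFamily

/-! ### Second family: graphs with the identity block on the right. -/

section ReversedFamily

variable {F : Type*} [Field F] {a k : ℕ}

variable (F a k) in
/-- The embedding `(x, y) ↦ (y | x)`. -/
def revEmb : (Fin k → F) × (Fin a → F) →ₗ[F] (Fin (a + k) → F) :=
  (blockIns (a + k) a k).coprod (blockIns (a + k) 0 a)

theorem blockProj_revEmb_left (x : Fin k → F) (y : Fin a → F) :
    blockProj (a + k) 0 a (revEmb F a k (x, y)) = y := by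
  rw [revEmb, LinearMap.coprod_apply, map_add, blockProj_blockIns_self (by omega),
    blockProj_blockIns_disjoint _ (by omega), zero_add]

theorem blockProj_revEmb_right (x : Fin k → F) (y : Fin a → F) :
    blockProj (a + k) a k (revEmb F a k (x, y)) = x := by
  rw [revEmb, LinearMap.coprod_apply, map_add, blockProj_blockIns_self (by omega),
    blockProj_blockIns_disjoint _ (by omega), add_zero]

theorem revEmb_injective : Function.Injective (revEmb F a k) := by
  rintro ⟨x, y⟩ ⟨x', y'⟩ he
  have h1 := congrArg (blockProj (a + k) 0 a) he
  have h2 := congrArg (blockProj (a + k) a k) he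
  rw [blockProj_revEmb_left, blockProj_revEmb_left] at h1
  rw [blockProj_revEmb_right, blockProj_revEmb_right] at h2
  rw [h1, h2]

theorem graphCode_revEmb_inf_ker (N : (Fin k → F) →ₗ[F] (Fin a → F)) :
    graphCode (revEmb F a k) N ⊓ LinearMap.ker (blockProj (a + k) a k) = ⊥ := by
  rw [eq_bot_iff]
  rintro _ ⟨⟨x, rfl⟩, hv⟩
  have hv : blockProj (a + k) a k (revEmb F a k (x, N x)) = 0 := hv
  rw [blockProj_revEmb_right] at hv
  rw [hv, map_zero]
  exact Submodule.zero_mem _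

/-- The kernel of `N` embeds as the vectors `(0 | x)`; the rank bound on `N` makes it large. -/
theorem le_finrank_graphCode_revEmb_inf_ker {N : (Fin k → F) →ₗ[F] (Fin a → F)} {δ : ℕ}
    (hN : Module.finrank F (LinearMap.range N) + δ ≤ k) :
    δ ≤ Module.finrank F (graphCode (revEmb F a k) N ⊓ LinearMap.ker (blockProj (a + k) 0 a) :
      Submodule F (Fin (a + k) → F)) := by
  have h := LinearMap.finrank_range_add_finrank_ker N
  rw [Module.finrank_fin_fun] at h
  refine (by omega : δ ≤ Module.finrank F (LinearMap.ker N)).trans ?_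
  refine le_finrank_of_injective
    ((revEmb F a k ∘ₗ LinearMap.id.prod N) ∘ₗ (LinearMap.ker N).subtype) ?_ ?_
  · intro x y hxy
    exact Subtype.ext (congrArg Prod.fst (revEmb_injective hxy))
  · intro x
    refine ⟨⟨x, rfl⟩, ?_⟩
    change blockProj (a + k) 0 a (revEmb F a k (x, N x)) = 0
    rw [blockProj_revEmb_left]
    exact x.2

end ReversedFamily

/-! ### Third family: shifted block matrices. -/

section StaircaseFamily

variable {F : Type*} [Field F]

section Map

variable {X Y A B₁ B₂ : Type*} [AddCommGroup X] [Module F X] [FiniteDimensional F X]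
  [AddCommGroup Y] [Module F Y] [FiniteDimensional F Y]
  [AddCommGroup A] [Module F A] [FiniteDimensional F A]
  [AddCommGroup B₁] [Module F B₁] [FiniteDimensional F B₁]
  [AddCommGroup B₂] [Module F B₂] [FiniteDimensional F B₂]

/-- The block triangular map `(x, y) ↦ (P x, R x + (0, S y))`. -/
def stairMap (P : X →ₗ[F] A) (S : Y →ₗ[F] B₂) (R : X →ₗ[F] B₁ × B₂) :
    X × Y →ₗ[F] A × (B₁ × B₂) :=
  (P.prod R).coprod (LinearMap.inr F A (B₁ × B₂) ∘ₗ LinearMap.inr F B₁ B₂ ∘ₗ S)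

theorem stairMap_apply (P : X →ₗ[F] A) (S : Y →ₗ[F] B₂) (R : X →ₗ[F] B₁ × B₂) (x : X) (y : Y) :
    stairMap P S R (x, y) = (P x, ((R x).1, (R x).2 + S y)) := by
  simp [stairMap, Prod.ext_iff]

theorem stairMap_sub (P P' : X →ₗ[F] A) (S S' : Y →ₗ[F] B₂) (R R' : X →ₗ[F] B₁ × B₂) :
    stairMap P S R - stairMap P' S' R' = stairMap (P - P') (S - S') (R - R') := by
  refine LinearMap.ext fun ⟨x, y⟩ => ?_
  rw [LinearMap.sub_apply, stairMap_apply, stairMap_apply, stairMap_apply]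
  refine Prod.ext rfl (Prod.ext rfl ?_)
  simp only [Prod.snd_sub, LinearMap.sub_apply]
  abel

/-- The range of `stairMap` projects onto that of `P`, and the inputs with `x = 0` put a copy of the
range of `S` in the kernel of that projection. -/
theorem finrank_range_add_le_stairMap (P : X →ₗ[F] A) (S : Y →ₗ[F] B₂) (R : X →ₗ[F] B₁ × B₂) :
    Module.finrank F (LinearMap.range P) + Module.finrank F (LinearMap.range S)
      ≤ Module.finrank F (LinearMap.range (stairMap P S R)) := by
  rw [← finrank_map_add_finrank_inf_ker (LinearMap.range (stairMap P S R))
    (LinearMap.fst F A (B₁ × B₂))]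
  refine Nat.add_le_add (Submodule.finrank_mono ?_) ?_
  · rintro _ ⟨x, rfl⟩
    exact ⟨_, ⟨(x, 0), rfl⟩, by rw [stairMap_apply]; rfl⟩
  · refine le_finrank_of_injective
      (LinearMap.inr F A (B₁ × B₂) ∘ₗ LinearMap.inr F B₁ B₂ ∘ₗ (LinearMap.range S).subtype) ?_ ?_
    · intro x y hxy
      exact Subtype.ext (congrArg (fun z => z.2.2) hxy)
    · rintro ⟨_, ⟨y, rfl⟩⟩
      refine ⟨⟨(0, y), ?_⟩, rfl⟩
      rw [stairMap_apply, map_zero, map_zero]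
      simp

theorem finrank_range_le_stairMap (P : X →ₗ[F] A) (S : Y →ₗ[F] B₂) (R : X →ₗ[F] B₁ × B₂) :
    Module.finrank F (LinearMap.range R) ≤ Module.finrank F (LinearMap.range (stairMap P S R)) := by
  rw [← finrank_map_add_finrank_inf_ker (LinearMap.range (stairMap P S R))
    (LinearMap.snd F A (B₁ × B₂))]
  refine (Submodule.finrank_mono ?_).trans (Nat.le_add_right _ _)
  rintro _ ⟨x, rfl⟩
  exact ⟨_, ⟨(x, 0), rfl⟩, by rw [stairMap_apply, map_zero, add_zero]; rfl⟩

end Map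

variable {n N s κ l g δ m : ℕ}

variable (F n N s κ l g δ m) in
/-- The embedding `((x, y), (a, (b₁, b₂))) ↦ (0_s | x | a || b₁ | y | b₂)`, where the second half
starts at position `N`. -/
def stairEmb : ((Fin κ → F) × (Fin δ → F)) × ((Fin l → F) × ((Fin g → F) × (Fin m → F))) →ₗ[F]
    (Fin n → F) :=
  ((blockIns n s κ).coprod (blockIns n (N + g) δ)).coprod
    ((blockIns n (s + κ) l).coprod ((blockIns n N g).coprod (blockIns n (N + g + δ) m)))

theorem stairEmb_apply (x : Fin κ → F) (y : Fin δ → F) (a : Fin l → F) (b₁ : Fin g → F)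
    (b₂ : Fin m → F) :
    stairEmb F n N s κ l g δ m ((x, y), (a, (b₁, b₂)))
      = blockIns n s κ x + blockIns n (N + g) δ y + (blockIns n (s + κ) l a +
        (blockIns n N g b₁ + blockIns n (N + g + δ) m b₂)) := rfl

theorem blockProj_stairEmb_x (h₁ : s + κ + l ≤ N) (h₂ : N + g + δ + m ≤ n) (x : Fin κ → F)
    (y : Fin δ → F) (a : Fin l → F) (b₁ : Fin g → F) (b₂ : Fin m → F) :
    blockProj n s κ (stairEmb F n N s κ l g δ m ((x, y), (a, (b₁, b₂)))) = x := by
  simp only [stairEmb_apply, map_add]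
  rw [blockProj_blockIns_self (by omega), blockProj_blockIns_disjoint n (by omega),
    blockProj_blockIns_disjoint n (by omega), blockProj_blockIns_disjoint n (by omega),
    blockProj_blockIns_disjoint n (by omega)]
  simp

theorem blockProj_stairEmb_y (h₁ : s + κ + l ≤ N) (h₂ : N + g + δ + m ≤ n) (x : Fin κ → F)
    (y : Fin δ → F) (a : Fin l → F) (b₁ : Fin g → F) (b₂ : Fin m → F) :
    blockProj n (N + g) δ (stairEmb F n N s κ l g δ m ((x, y), (a, (b₁, b₂)))) = y := by
  simp only [stairEmb_apply, map_add]
  rw [blockProj_blockIns_self (by omega), blockProj_blockIns_disjoint n (by omega),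
    blockProj_blockIns_disjoint n (by omega), blockProj_blockIns_disjoint n (by omega),
    blockProj_blockIns_disjoint n (by omega)]
  simp

theorem blockProj_stairEmb_a (h₁ : s + κ + l ≤ N) (h₂ : N + g + δ + m ≤ n) (x : Fin κ → F)
    (y : Fin δ → F) (a : Fin l → F) (b₁ : Fin g → F) (b₂ : Fin m → F) :
    blockProj n (s + κ) l (stairEmb F n N s κ l g δ m ((x, y), (a, (b₁, b₂)))) = a := by
  simp only [stairEmb_apply, map_add]
  rw [blockProj_blockIns_self (by omega), blockProj_blockIns_disjoint n (by omega),
    blockProj_blockIns_disjoint n (by omega), blockProj_blockIns_disjoint n (by omega),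
    blockProj_blockIns_disjoint n (by omega)]
  simp

theorem blockProj_stairEmb_b₁ (h₁ : s + κ + l ≤ N) (h₂ : N + g + δ + m ≤ n) (x : Fin κ → F)
    (y : Fin δ → F) (a : Fin l → F) (b₁ : Fin g → F) (b₂ : Fin m → F) :
    blockProj n N g (stairEmb F n N s κ l g δ m ((x, y), (a, (b₁, b₂)))) = b₁ := by
  simp only [stairEmb_apply, map_add]
  rw [blockProj_blockIns_self (by omega), blockProj_blockIns_disjoint n (by omega),
    blockProj_blockIns_disjoint n (by omega), blockProj_blockIns_disjoint n (by omega),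
    blockProj_blockIns_disjoint n (by omega)]
  simp

theorem blockProj_stairEmb_b₂ (h₁ : s + κ + l ≤ N) (h₂ : N + g + δ + m ≤ n) (x : Fin κ → F)
    (y : Fin δ → F) (a : Fin l → F) (b₁ : Fin g → F) (b₂ : Fin m → F) :
    blockProj n (N + g + δ) m (stairEmb F n N s κ l g δ m ((x, y), (a, (b₁, b₂)))) = b₂ := by
  simp only [stairEmb_apply, map_add]
  rw [blockProj_blockIns_self (by omega), blockProj_blockIns_disjoint n (by omega),
    blockProj_blockIns_disjoint n (by omega), blockProj_blockIns_disjoint n (by omega),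
    blockProj_blockIns_disjoint n (by omega)]
  simp

theorem stairEmb_injective (h₁ : s + κ + l ≤ N) (h₂ : N + g + δ + m ≤ n) :
    Function.Injective (stairEmb F n N s κ l g δ m) := by
  rintro ⟨⟨x, y⟩, ⟨a, ⟨b₁, b₂⟩⟩⟩ ⟨⟨x', y'⟩, ⟨a', ⟨b₁', b₂'⟩⟩⟩ he
  have hx := congrArg (blockProj n s κ) he
  have hy := congrArg (blockProj n (N + g) δ) he
  have ha := congrArg (blockProj n (s + κ) l) he
  have hb₁ := congrArg (blockProj n N g) he
  have hb₂ := congrArg (blockProj n (N + g + δ) m) he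
  rw [blockProj_stairEmb_x h₁ h₂, blockProj_stairEmb_x h₁ h₂] at hx
  rw [blockProj_stairEmb_y h₁ h₂, blockProj_stairEmb_y h₁ h₂] at hy
  rw [blockProj_stairEmb_a h₁ h₂, blockProj_stairEmb_a h₁ h₂] at ha
  rw [blockProj_stairEmb_b₁ h₁ h₂, blockProj_stairEmb_b₁ h₁ h₂] at hb₁
  rw [blockProj_stairEmb_b₂ h₁ h₂, blockProj_stairEmb_b₂ h₁ h₂] at hb₂
  rw [hx, hy, ha, hb₁, hb₂]

variable {P : (Fin κ → F) →ₗ[F] (Fin l → F)} {S : (Fin δ → F) →ₗ[F] (Fin m → F)}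
  {R : (Fin κ → F) →ₗ[F] (Fin g → F) × (Fin m → F)}

variable (n N s g P S R) in
/-- The row space of a block matrix `(0_s | I | P || R₁ | 0 | R₂; 0 | 0 | 0 || 0_g | I | S)`. -/
def stairCode : Submodule F (Fin n → F) :=
  graphCode (stairEmb F n N s κ l g δ m) (stairMap P S R)

theorem finrank_stairCode (h₁ : s + κ + l ≤ N) (h₂ : N + g + δ + m ≤ n) :
    Module.finrank F (stairCode n N s g P S R) = κ + δ := by
  rw [stairCode, finrank_graphCode (stairEmb_injective h₁ h₂), Module.finrank_prod,
    Module.finrank_fin_fun, Module.finrank_fin_fun]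

theorem finrank_stairCode_inf (h₁ : s + κ + l ≤ N) (h₂ : N + g + δ + m ≤ n)
    (P P' : (Fin κ → F) →ₗ[F] (Fin l → F)) (S S' : (Fin δ → F) →ₗ[F] (Fin m → F))
    (R R' : (Fin κ → F) →ₗ[F] (Fin g → F) × (Fin m → F)) :
    Module.finrank F (stairCode n N s g P S R ⊓ stairCode n N s g P' S' R' :
        Submodule F (Fin n → F)) +
      Module.finrank F (LinearMap.range (stairMap (P - P') (S - S') (R - R'))) ≤ κ + δ := by
  rw [← stairMap_sub]
  refine (finrank_graphCode_inf (D := (Fin κ → F) × (Fin δ → F))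
    (Q := (Fin l → F) × ((Fin g → F) × (Fin m → F))) (e := stairEmb F n N s κ l g δ m)
    (stairEmb_injective h₁ h₂) _ _).trans ?_
  rw [Module.finrank_prod, Module.finrank_fin_fun, Module.finrank_fin_fun]

theorem le_finrank_stairCode_inf_ker_left (h₁ : s + κ + l ≤ N) (h₂ : N + g + δ + m ≤ n) :
    δ ≤ Module.finrank F (stairCode n N s g P S R ⊓
      LinearMap.ker (blockProj n 0 N) : Submodule F (Fin n → F)) := by
  conv_lhs => rw [← Module.finrank_fin_fun F (n := δ)]
  refine le_finrank_of_injective ((stairEmb F n N s κ l g δ m ∘ₗ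
    LinearMap.id.prod (stairMap P S R)) ∘ₗ LinearMap.inr F (Fin κ → F) (Fin δ → F)) ?_ ?_
  · intro x y hxy
    exact congrArg (fun z => z.1.2) (stairEmb_injective h₁ h₂ hxy)
  · intro y
    refine ⟨⟨_, rfl⟩, ?_⟩
    change blockProj n 0 N (stairEmb F n N s κ l g δ m ((0, y), stairMap P S R (0, y))) = 0
    rw [stairMap_apply, map_zero, map_zero, stairEmb_apply]
    simp only [map_add, map_zero, Prod.fst_zero]
    rw [blockProj_blockIns_disjoint n (by omega), blockProj_blockIns_disjoint n (by omega)]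
    simp only [zero_add]
    rw [blockProj_blockIns_disjoint n (by omega)]

/-- Vectors with `y = 0` and `x` in the kernel of `R` vanish beyond position `N`. -/
theorem le_finrank_stairCode_inf_ker_right (h₁ : s + κ + l ≤ N) (h₂ : N + g + δ + m ≤ n)
    {δ' o b : ℕ} (hR : Module.finrank F (LinearMap.range R) + δ' ≤ κ) (ho : N ≤ o) :
    δ' ≤ Module.finrank F (stairCode n N s g P S R ⊓
      LinearMap.ker (blockProj n o b) : Submodule F (Fin n → F)) := by
  have h := LinearMap.finrank_range_add_finrank_ker R
  rw [Module.finrank_fin_fun] at h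
  refine (by omega : δ' ≤ Module.finrank F (LinearMap.ker R)).trans ?_
  refine le_finrank_of_injective (((stairEmb F n N s κ l g δ m ∘ₗ
    LinearMap.id.prod (stairMap P S R)) ∘ₗ LinearMap.inl F (Fin κ → F) (Fin δ → F)) ∘ₗ
      (LinearMap.ker R).subtype) ?_ ?_
  · intro x y hxy
    exact Subtype.ext (congrArg (fun z => z.1.1) (stairEmb_injective h₁ h₂ hxy))
  · intro x
    refine ⟨⟨_, rfl⟩, ?_⟩
    change blockProj n o b (stairEmb F n N s κ l g δ m
      (((x : Fin κ → F), 0), stairMap P S R ((x : Fin κ → F), 0))) = 0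
    rw [stairMap_apply, LinearMap.mem_ker.1 x.2, map_zero, stairEmb_apply]
    simp only [map_add, map_zero, Prod.fst_zero, Prod.snd_zero, add_zero]
    rw [blockProj_blockIns_disjoint n (by omega), blockProj_blockIns_disjoint n (by omega)]
    simp

variable {s' l' g' m' : ℕ} {P' : (Fin κ → F) →ₗ[F] (Fin l' → F)}
  {S' : (Fin δ → F) →ₗ[F] (Fin m' → F)} {R' : (Fin κ → F) →ₗ[F] (Fin g' → F) × (Fin m' → F)}

/-- The `δ` coordinates from `s` on are arbitrary on the first space, being part of its identity
block, but vanish on the second, which starts later. -/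
theorem finrank_stairCode_inf_add_le_of_left (h₁ : s + κ + l ≤ N) (h₂ : N + g + δ + m ≤ n)
    (h₁' : s' + κ + l' ≤ N) (hδ : δ ≤ κ) (hs : s + δ ≤ s') :
    Module.finrank F (stairCode n N s g P S R ⊓
      stairCode n N s' g' P' S' R' : Submodule F (Fin n → F)) + δ
      ≤ κ + δ := by
  have h0 : Module.finrank F (stairCode n N s g P S R) = κ + δ :=
    finrank_stairCode h₁ h₂
  rw [← finrank_map_add_finrank_inf_ker _ (blockProj n s δ)] at h0
  have h3 : δ ≤ Module.finrank F ((stairCode n N s g P S R).map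
      (blockProj n s δ)) := by
    conv_lhs => rw [← Module.finrank_fin_fun F (n := δ)]
    refine le_finrank_of_injective LinearMap.id (fun _ _ h => h) fun z => ?_
    refine ⟨_, ⟨(blockIns κ 0 δ z, 0), rfl⟩, ?_⟩
    change blockProj n s δ (stairEmb F n N s κ l g δ m
      ((blockIns κ 0 δ z, 0), stairMap P S R (blockIns κ 0 δ z, 0))) = z
    rw [stairMap_apply, stairEmb_apply, blockIns_blockIns n s hδ]
    simp only [map_add, map_zero]
    rw [blockProj_blockIns_self (by omega), blockProj_blockIns_disjoint n (by omega),
      blockProj_blockIns_disjoint n (by omega), blockProj_blockIns_disjoint n (by omega)]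
    simp
  have h4 : Module.finrank F (stairCode n N s g P S R ⊓
      stairCode n N s' g' P' S' R' : Submodule F (Fin n → F))
      ≤ Module.finrank F (stairCode n N s g P S R ⊓
        LinearMap.ker (blockProj n s δ) : Submodule F (Fin n → F)) := by
    refine Submodule.finrank_mono (inf_le_inf_left _ ?_)
    rintro _ ⟨⟨x, y⟩, rfl⟩
    change blockProj n s δ (stairEmb F n N s' κ l' g' δ m' ((x, y), stairMap P' S' R' (x, y))) = 0
    rw [stairMap_apply, stairEmb_apply]
    simp only [map_add]
    rw [blockProj_blockIns_disjoint n (by omega), blockProj_blockIns_disjoint n (by omega),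
      blockProj_blockIns_disjoint n (by omega)]
    simp only [← map_add]
    rw [map_add, blockProj_blockIns_disjoint n (by omega),
      blockProj_blockIns_disjoint n (by omega)]
    simp
  omega

/-- A common vector vanishing on the left half has `x = x' = 0`; its `y` then sits where the second
space is still zero. So the intersection avoids the kernel of the left projection, which meets the
first space in dimension at least `δ`. -/
theorem finrank_stairCode_inf_add_le_of_right (h₁ : s + κ + l ≤ N) (h₂ : N + g + δ + m ≤ n)
    (h₁' : s + κ + l' ≤ N) (h₂' : N + g' + δ + m' ≤ n) (hg : g + δ ≤ g') :
    Module.finrank F (stairCode n N s g P S R ⊓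
      stairCode n N s g' P' S' R' : Submodule F (Fin n → F)) + δ
      ≤ κ + δ := by
  have h0 : Module.finrank F (stairCode n N s g P S R) = κ + δ :=
    finrank_stairCode h₁ h₂
  have h3 := finrank_inf_add_le_of_ker (f := blockProj n 0 N)
    (Z₁ := stairCode n N s g P S R ⊓
      stairCode n N s g' P' S' R')
    (Z₂ := stairCode n N s g P S R) ?_
    (le_finrank_stairCode_inf_ker_left h₁ h₂)
  · rwa [h0, inf_eq_left.2 inf_le_left] at h3
  rw [eq_bot_iff]
  rintro _ ⟨⟨⟨⟨x, y⟩, rfl⟩, ⟨⟨x', y'⟩, he⟩⟩, hv⟩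
  have hv : blockProj n 0 N (stairEmb F n N s κ l g δ m ((x, y), stairMap P S R (x, y))) = 0 := hv
  have he : stairEmb F n N s κ l' g' δ m' ((x', y'), stairMap P' S' R' (x', y'))
    = stairEmb F n N s κ l g δ m ((x, y), stairMap P S R (x, y)) := he
  rw [stairMap_apply] at hv he
  have hx := blockProj_eq_zero_of_le hv (o' := s) (b' := κ) (by omega) (by omega)
  rw [blockProj_stairEmb_x h₁ h₂] at hx
  subst hx
  have hx' := congrArg (blockProj n s κ) he
  rw [stairMap_apply, blockProj_stairEmb_x h₁ h₂, blockProj_stairEmb_x h₁' h₂'] at hx'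
  subst hx'
  have hy := congrArg (blockProj n (N + g) δ) he
  rw [stairMap_apply, blockProj_stairEmb_y h₁ h₂, map_zero, map_zero, stairEmb_apply] at hy
  simp only [map_add, map_zero, Prod.fst_zero, Prod.snd_zero] at hy
  rw [blockProj_blockIns_disjoint n (by omega), blockProj_blockIns_disjoint n (by omega)] at hy
  simp only [add_zero] at hy
  subst hy
  rw [show ((0 : Fin κ → F), (0 : Fin δ → F)) = 0 from rfl, map_zero]
  exact Submodule.zero_mem _

end StaircaseFamily

universe u

/-! ### From packings to lower bounds on `maxCDC`. -/

section Packing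

variable {F : Type u} [Field F] {n : ℕ}

/-- A family of `k`-dimensional subspaces, any two of which meet in dimension at most `k - δ`. -/
structure IsPacking {I : Type*} (W : I → Submodule F (Fin n → F)) (k δ : ℕ) : Prop where
  finrank_eq : ∀ i, Module.finrank F (W i) = k
  inf_le : ∀ i j, i ≠ j → Module.finrank F (W i ⊓ W j : Submodule F (Fin n → F)) + δ ≤ k

theorem IsPacking.sumElim {I J : Type*} {W : I → Submodule F (Fin n → F)}
    {W' : J → Submodule F (Fin n → F)} {k δ : ℕ} (h : IsPacking W k δ) (h' : IsPacking W' k δ)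
    (hc : ∀ i j, Module.finrank F (W i ⊓ W' j : Submodule F (Fin n → F)) + δ ≤ k) :
    IsPacking (Sum.elim W W') k δ where
  finrank_eq i := by
    rcases i with i | i
    · exact h.finrank_eq i
    · exact h'.finrank_eq i
  inf_le i j hij := by
    rcases i with i | i <;> rcases j with j | j
    · exact h.inf_le i j fun e => hij (congrArg _ e)
    · exact hc i j
    · rw [inf_comm]
      exact hc j i
    · exact h'.inf_le i j fun e => hij (congrArg _ e)

theorem subspaceDist_add (U V : Submodule F (Fin n → F)) :
    subspaceDist U V + 2 * Module.finrank F (U ⊓ V : Submodule F (Fin n → F))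
      = Module.finrank F U + Module.finrank F V := by
  have h := Submodule.finrank_sup_add_finrank_inf_eq U V
  have h1 : Module.finrank F (U ⊓ V : Submodule F (Fin n → F))
      ≤ Module.finrank F (U ⊔ V : Submodule F (Fin n → F)) :=
    Submodule.finrank_mono (inf_le_left.trans le_sup_left)
  rw [subspaceDist]
  omega

theorem IsPacking.natCard_le_maxCDC [Finite F] {I : Type*} [Nonempty I]
    {W : I → Submodule F (Fin n → F)} {k δ : ℕ} (hδ : 0 < δ) (h : IsPacking W k δ) :
    Nat.card I ≤ maxCDC F n (2 * δ) k := by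
  have hinj : Function.Injective W := by
    intro i j hij
    by_contra hne
    have h1 := h.inf_le i j hne
    rw [← hij, inf_idem, h.finrank_eq] at h1
    omega
  -- Finiteness bounds the set of code sizes; an unbounded one would have supremum `0`.
  refine le_csSup ⟨Nat.card (Submodule F (Fin n → F)), ?_⟩ ⟨Set.range W, ⟨?_, ?_, ?_⟩, ?_⟩
  · rintro _ ⟨C, -, rfl⟩
    rw [← Set.ncard_univ]
    exact Set.ncard_le_ncard (Set.subset_univ _)
  · exact Set.range_nonempty W
  · rintro _ ⟨i, rfl⟩ _ ⟨j, rfl⟩ hij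
    have h1 := h.inf_le i j fun e => hij (congrArg W e)
    have h2 := subspaceDist_add (W i) (W j)
    rw [h.finrank_eq, h.finrank_eq] at h2
    omega
  · intro i
    rw [Finset.mem_singleton, eta, Set.ncard_pos]
    constructor
    · rintro ⟨_, ⟨j, rfl⟩, hj⟩
      rw [← hj, h.finrank_eq]
    · rintro rfl
      obtain ⟨j⟩ := ‹Nonempty I›
      exact ⟨W j, ⟨j, rfl⟩, h.finrank_eq j⟩
  · rw [← Nat.card_coe_set_eq]
    exact Nat.card_range_of_injective hinj

end Packing

/-! ### The three families as packings, with their sizes. -/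

section Families

variable {F : Type u} [Field F] [Finite F] {n : ℕ}

theorem minGap_le {T : Finset ℕ} {u v : ℕ} (hu : u ∈ T) (hv : v ∈ T) (h : v < u) :
    minGap T ≤ u - v := by
  rw [minGap, if_pos (Finset.one_lt_card.2 ⟨u, hu, v, hv, h.ne'⟩)]
  exact Nat.sInf_le ⟨u, hu, v, hv, h, rfl⟩

theorem IsMDDC.finrank_mem {n₁ d₁ d₀ : ℕ} {X : Set (Submodule F (Fin n₁ → F))} {T : Finset ℕ}
    (hX : IsMDDC X d₁ d₀ T) {U : Submodule F (Fin n₁ → F)} (hU : U ∈ X) :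
    Module.finrank F U ∈ T := by
  rw [← hX.dims, eta, Set.ncard_pos]
  exact ⟨U, hU, rfl⟩

/-- For dimensions `t < t'` the distance is at least `2 * δ - (t' - t)`, so `U ⊓ U'` has dimension
at most `t' - δ`; the padding adds only the smaller `k - t'`. -/
theorem IsMDDC.finrank_inf_add_min_le {n₁ δ k : ℕ} {X : Set (Submodule F (Fin n₁ → F))}
    {T : Finset ℕ} (hX : IsMDDC X (2 * δ) (2 * δ - minGap T) T) (hgap : minGap T < 2 * δ)
    {U U' : Submodule F (Fin n₁ → F)} (hU : U ∈ X) (hU' : U' ∈ X) (hne : U ≠ U')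
    (hUk : Module.finrank F U ≤ k) (hUk' : Module.finrank F U' ≤ k) :
    Module.finrank F (U ⊓ U' : Submodule F (Fin n₁ → F)) +
      min (k - Module.finrank F U) (k - Module.finrank F U') + δ ≤ k := by
  have h2 := subspaceDist_add U U'
  rcases lt_trichotomy (Module.finrank F U) (Module.finrank F U') with h | h | h
  · have h5 := hX.dist_diff U hU U' hU' h.ne
    have h6 := minGap_le (hX.finrank_mem hU') (hX.finrank_mem hU) h
    omega
  · have h5 := hX.dist_same U hU U' hU' hne h
    omega
  · have h5 := hX.dist_diff U hU U' hU' h.ne'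
    have h6 := minGap_le (hX.finrank_mem hU) (hX.finrank_mem hU') h
    omega

/-- Lifting the codewords of a mixed dimension/distance code by MRD codes. -/
theorem exists_packing_lift {n₁ n₂ k δ τ : ℕ} (hn : n = n₁ + n₂) (hδ : 1 ≤ δ) (hδk : δ ≤ k)
    (hk : 2 * k ≤ n₂ + τ) {T : Finset ℕ} (hτ : ∀ t ∈ T, τ ≤ t) (hTk : ∀ t ∈ T, t ≤ k)
    (hgap : minGap T < 2 * δ) {X : Set (Submodule F (Fin n₁ → F))}
    (hX : IsMDDC X (2 * δ) (2 * δ - minGap T) T) :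
    ∃ (I : Type u) (_ : Finite I) (W : I → Submodule F (Fin n → F)), IsPacking W k δ ∧
      (∀ i b, n₁ + k - τ ≤ b → W i ⊓ LinearMap.ker (blockProj n 0 b) = ⊥) ∧
      Nat.card I = ∑ t ∈ T, eta X t * mrdSize (Nat.card F) k (n₂ + t - k) δ := by
  classical
  have hτU : ∀ U : X, τ ≤ Module.finrank F U.1 := fun U => hτ _ (hX.finrank_mem U.2)
  have hUk : ∀ U : X, Module.finrank F U.1 ≤ k := fun U => hTk _ (hX.finrank_mem U.2)
  have hdim : ∀ U : X, Module.finrank F (U.1 × (Fin (k - Module.finrank F U.1) → F)) = k := by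
    intro U
    have := hUk U
    rw [Module.finrank_prod, Module.finrank_fin_fun]
    omega
  have hle : ∀ U : X, n₁ + (k - Module.finrank F U.1) + (n₂ + Module.finrank F U.1 - k) ≤ n := by
    intro U
    have := hUk U
    have := hτU U
    omega
  have hG : ∀ U : X, ∃ G : Submodule F ((U.1 × (Fin (k - Module.finrank F U.1) → F)) →ₗ[F]
      (Fin (n₂ + Module.finrank F U.1 - k) → F)), MinRank G δ ∧
        Nat.card G = mrdSize (Nat.card F) k (n₂ + Module.finrank F U.1 - k) δ := by
    intro U
    have h1 := hUk U
    have h2 := hτU U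
    obtain ⟨G, hG, hc, -⟩ := exists_mrd_of_le (F := F)
      (V := U.1 × (Fin (k - Module.finrank F U.1) → F))
      (W := Fin (n₂ + Module.finrank F U.1 - k) → F) hδ (by rw [hdim]; exact hδk)
      (by rw [hdim, Module.finrank_fin_fun]; omega)
    rw [hdim, Module.finrank_fin_fun] at hc
    exact ⟨G, hG, hc⟩
  choose G hmin hcard using hG
  have hfinG : ∀ U : X, Finite (G U) := fun U => Module.finite_of_finite F
  refine ⟨Σ U : X, G U, inferInstance, fun p =>
    liftCode n p.1.1 p.2.1, ⟨?_, ?_⟩, ?_, ?_⟩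
  · intro p
    refine (finrank_liftCode (hle p.1) p.2.1).trans ?_
    have := hUk p.1
    omega
  · rintro ⟨U, M⟩ ⟨U', M'⟩ hne
    change Module.finrank F
      (liftCode n U.1 M.1 ⊓ liftCode n U'.1 M'.1 : Submodule F (Fin n → F)) + δ ≤ k
    by_cases hU : U = U'
    · subst hU
      have h1 := finrank_liftCode_inf (hle U) M.1 M'.1
      rw [Nat.add_sub_cancel' (hUk U)] at h1
      have h2 := hmin U (M.1 - M'.1) (Submodule.sub_mem _ M.2 M'.2) fun h0 =>
        hne (by rw [Subtype.ext (sub_eq_zero.1 h0)])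
      exact le_trans (Nat.add_le_add_left h2 _) h1
    · exact le_trans (Nat.add_le_add_right
        (finrank_liftCode_inf_le (hle U) (hle U') M.1 M'.1) δ)
        (hX.finrank_inf_add_min_le hgap U.2 U'.2 (fun e => hU (Subtype.ext e)) (hUk U) (hUk U'))
  · rintro ⟨U, M⟩ b hb
    -- The padding has length at most `k - τ`, so the prefix `(u | p)` always fits in the first `b`
    -- coordinates.
    have h3 := hUk U
    have h4 := hτU U
    exact liftCode_inf_ker (hle U) M.1 (by omega)
  · have := Fintype.ofFinite X
    rw [Nat.card_sigma, Finset.sum_congr rfl fun U _ => hcard U,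
      ← Finset.sum_fiberwise_of_maps_to (g := fun U : X => Module.finrank F U.1) (t := T)
        fun U _ => hX.finrank_mem U.2]
    refine Finset.sum_congr rfl fun t _ => ?_
    rw [Finset.sum_congr rfl (g := fun _ => mrdSize (Nat.card F) k (n₂ + t - k) δ) fun U hU => by
        rw [(Finset.mem_filter.1 hU).2], Finset.sum_const, smul_eq_mul]
    congr 1
    rw [eta, ← Nat.card_coe_set_eq, ← Fintype.card_subtype, ← Nat.card_eq_fintype_card]
    exact Nat.card_congr (Equiv.subtypeSubtypeEquivSubtypeInter (fun U => U ∈ X)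
      fun U => Module.finrank F U = t)

/-- Lifted MRD codewords of bounded rank, with the identity block on the right. -/
theorem exists_packing_rev {a k δ : ℕ} (hδ : 1 ≤ δ) (hδk : δ ≤ k) (hka : k ≤ a) :
    ∃ (I : Type u) (_ : Finite I) (W : I → Submodule F (Fin (a + k) → F)), IsPacking W k δ ∧
      (∀ i, W i ⊓ LinearMap.ker (blockProj (a + k) a k) = ⊥) ∧
      (∀ i, δ ≤ Module.finrank F (W i ⊓ LinearMap.ker (blockProj (a + k) 0 a) :
        Submodule F (Fin (a + k) → F))) ∧
      (Nat.card I : ℚ) = mrdSizeRestr (Nat.card F) k a δ (k - δ) := by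
  obtain ⟨G, hmin, -, hcard⟩ := exists_mrd_of_le (F := F) (V := Fin k → F) (W := Fin a → F) hδ
    (by rwa [Module.finrank_fin_fun]) (by rwa [Module.finrank_fin_fun, Module.finrank_fin_fun])
  rw [Module.finrank_fin_fun, Module.finrank_fin_fun] at hcard
  have : Finite ((Fin k → F) →ₗ[F] (Fin a → F)) := Module.finite_of_finite F
  refine ⟨_, inferInstance, fun N : {f : (Fin k → F) →ₗ[F] (Fin a → F) //
    f ∈ G ∧ Module.finrank F (LinearMap.range f) ≤ k - δ} => graphCode (revEmb F a k) N.1,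
    ⟨fun N => ?_, fun N N' hne => ?_⟩, fun N => graphCode_revEmb_inf_ker N.1, fun N => ?_,
    hcard _ (Nat.sub_le _ _)⟩
  · have h1 := finrank_graphCode (D := Fin k → F) (Q := Fin a → F) (e := revEmb F a k)
      revEmb_injective N.1
    rwa [Module.finrank_fin_fun] at h1
  · have h1 := finrank_graphCode_inf (D := Fin k → F) (Q := Fin a → F) (e := revEmb F a k)
      revEmb_injective N.1 N'.1
    rw [Module.finrank_fin_fun] at h1
    change Module.finrank F (graphCode (revEmb F a k) N.1 ⊓ graphCode (revEmb F a k) N'.1 :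
      Submodule F (Fin (a + k) → F)) + δ ≤ k
    have h2 := hmin (N.1 - N'.1) (Submodule.sub_mem _ N.2.1 N'.2.1) fun h0 =>
      hne (Subtype.ext (sub_eq_zero.1 h0))
    exact le_trans (Nat.add_le_add_left h2 _) h1
  · have h := N.2.2
    exact le_finrank_graphCode_revEmb_inf_ker (by omega)

/-- The codewords inserted between the two previous families. -/
theorem exists_packing_stair {N N' κ δ θ₁ θ₂ : ℕ} (hn : N + N' = n) (hδ : 1 ≤ δ) (hδκ : δ ≤ κ)
    (hκN : κ + δ ≤ N') {l m : ℕ → ℕ} {d₁ d₂ : ℕ → ℕ → ℕ}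
    (hl : ∀ i ≤ θ₁, i * δ + κ + l i = N) (hlδ : ∀ i ≤ θ₁, δ ≤ l i)
    (hm : ∀ j ≤ θ₂, j * δ + δ + m j = N') (hmδ : ∀ j ≤ θ₂, δ ≤ m j)
    (hd : ∀ i ≤ θ₁, ∀ j ≤ θ₂, 1 ≤ d₁ i j ∧ 1 ≤ d₂ i j ∧ d₁ i j + d₂ i j = δ) :
    ∃ (I : Type u) (_ : Finite I) (W : I → Submodule F (Fin n → F)), IsPacking W (κ + δ) δ ∧
      (∀ i, δ ≤ Module.finrank F (W i ⊓ LinearMap.ker (blockProj n 0 N) :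
        Submodule F (Fin n → F))) ∧
      (∀ i o b, N ≤ o → δ ≤ Module.finrank F (W i ⊓ LinearMap.ker (blockProj n o b) :
        Submodule F (Fin n → F))) ∧
      (Nat.card I : ℚ) = mrdSizeRestr (Nat.card F) κ (N' - δ) δ (κ - δ) *
        ∑ i ∈ Finset.range (θ₁ + 1), ∑ j ∈ Finset.range (θ₂ + 1), (Nat.card F : ℚ) ^
          (min (max κ (l i) * d₂ i j) (m j * d₁ i j) + max κ (l i) * (min κ (l i) - δ + 1)
            + m j) := by
  have hi : ∀ p : Fin (θ₁ + 1) × Fin (θ₂ + 1), (p.1 : ℕ) ≤ θ₁ := fun p => by omega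
  have hj : ∀ p : Fin (θ₁ + 1) × Fin (θ₂ + 1), (p.2 : ℕ) ≤ θ₂ := fun p => by omega
  have hS : ∀ p : Fin (θ₁ + 1) × Fin (θ₂ + 1),
      ∃ S : Submodule F (((Fin κ → F) →ₗ[F] (Fin (l p.1) → F)) ×
          ((Fin δ → F) →ₗ[F] (Fin (m p.2) → F))),
        (∀ s ∈ S, s ≠ 0 → δ ≤
          Module.finrank F (LinearMap.range s.1) + Module.finrank F (LinearMap.range s.2)) ∧
        Nat.card S = Nat.card F ^ (min (max κ (l p.1) * d₂ p.1 p.2) (m p.2 * d₁ p.1 p.2)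
          + max κ (l p.1) * (min κ (l p.1) - δ + 1) + m p.2) := by
    intro p
    obtain ⟨h1, h2, h3⟩ := hd p.1 (hi p) p.2 (hj p)
    have h4 := hlδ p.1 (hi p)
    have h5 := hmδ p.2 (hj p)
    obtain ⟨S, hS1, hS2⟩ := exists_pair_code (F := F) (V := Fin κ → F) (W := Fin (l p.1) → F)
      (V' := Fin δ → F) (W' := Fin (m p.2) → F) h1 h2
      (by rw [Module.finrank_fin_fun, Module.finrank_fin_fun, h3]; exact le_min hδκ h4)
      (by rw [Module.finrank_fin_fun, Module.finrank_fin_fun, h3]; exact le_min le_rfl h5)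
    rw [h3] at hS1
    rw [h3, Module.finrank_fin_fun, Module.finrank_fin_fun, Module.finrank_fin_fun,
      Module.finrank_fin_fun, max_eq_right h5, min_eq_left h5, Nat.sub_self, zero_add,
      mul_one] at hS2
    exact ⟨S, hS1, hS2⟩
  have hG : ∀ p : Fin (θ₁ + 1) × Fin (θ₂ + 1),
      ∃ G : Submodule F ((Fin κ → F) →ₗ[F] (Fin (p.2 * δ) → F) × (Fin (m p.2) → F)),
        MinRank G δ ∧
        (Nat.card {f : (Fin κ → F) →ₗ[F] (Fin (p.2 * δ) → F) × (Fin (m p.2) → F) //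
          f ∈ G ∧ Module.finrank F (LinearMap.range f) ≤ κ - δ} : ℚ)
            = mrdSizeRestr (Nat.card F) κ (N' - δ) δ (κ - δ) := by
    intro p
    have h1 := hm p.2 (hj p)
    -- The two parts of `R` have total width `N' - δ` whatever the shift, so the number of choices
    -- of `R` factors out of the double sum.
    have h2 : Module.finrank F ((Fin (p.2 * δ) → F) × (Fin (m p.2) → F)) = N' - δ := by
      rw [Module.finrank_prod, Module.finrank_fin_fun, Module.finrank_fin_fun]
      omega
    obtain ⟨G, hmin, -, hcard⟩ := exists_mrd_of_le (F := F) (V := Fin κ → F)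
      (W := (Fin (p.2 * δ) → F) × (Fin (m p.2) → F)) hδ
      (by rwa [Module.finrank_fin_fun]) (by rw [h2, Module.finrank_fin_fun]; omega)
    rw [h2, Module.finrank_fin_fun] at hcard
    exact ⟨G, hmin, hcard _ (Nat.sub_le _ _)⟩
  choose S hS hScard using hS
  choose G hG hGcard using hG
  have hle₁ : ∀ p : Fin (θ₁ + 1) × Fin (θ₂ + 1), p.1 * δ + κ + l p.1 ≤ N :=
    fun p => (hl p.1 (hi p)).le
  have hle₂ : ∀ p : Fin (θ₁ + 1) × Fin (θ₂ + 1), N + p.2 * δ + δ + m p.2 ≤ n := by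
    intro p
    have h1 := hm p.2 (hj p)
    omega
  have hfinS : ∀ p, Finite (S p) := fun p => Module.finite_of_finite F
  have hfinG : ∀ p : Fin (θ₁ + 1) × Fin (θ₂ + 1),
      Finite ((Fin κ → F) →ₗ[F] (Fin (p.2 * δ) → F) × (Fin (m p.2) → F)) :=
    fun p => Module.finite_of_finite F
  refine ⟨Σ p : Fin (θ₁ + 1) × Fin (θ₂ + 1), S p ×
      {f : (Fin κ → F) →ₗ[F] (Fin (p.2 * δ) → F) × (Fin (m p.2) → F) //
        f ∈ G p ∧ Module.finrank F (LinearMap.range f) ≤ κ - δ}, inferInstance,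
    fun w => stairCode n N (w.1.1 * δ) (w.1.2 * δ) w.2.1.1.1 w.2.1.1.2 w.2.2.1,
    ⟨fun w => finrank_stairCode (hle₁ w.1) (hle₂ w.1), ?_⟩, fun w => ?_, fun w o b ho => ?_, ?_⟩
  · rintro ⟨p, A, R⟩ ⟨p', A', R'⟩ hne
    change Module.finrank F (stairCode n N (p.1 * δ) (p.2 * δ) A.1.1 A.1.2 R.1 ⊓
      stairCode n N (p'.1 * δ) (p'.2 * δ) A'.1.1 A'.1.2 R'.1 : Submodule F (Fin n → F)) + δ
      ≤ κ + δ
    have hmul : ∀ {x y : ℕ}, x < y → x * δ + δ ≤ y * δ := fun {x y} h => by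
      rw [← Nat.succ_mul]
      exact Nat.mul_le_mul_right δ h
    rcases lt_trichotomy (p.1 : ℕ) (p'.1 : ℕ) with h | h | h
    · exact finrank_stairCode_inf_add_le_of_left (hle₁ p) (hle₂ p) (hle₁ p') hδκ (hmul h)
    · obtain ⟨i, j⟩ := p
      obtain ⟨i', j'⟩ := p'
      obtain rfl : i = i' := Fin.ext h
      rcases lt_trichotomy (j : ℕ) (j' : ℕ) with h' | h' | h'
      · exact finrank_stairCode_inf_add_le_of_right (hle₁ (i, j)) (hle₂ (i, j)) (hle₁ (i, j'))
          (hle₂ (i, j')) (hmul h')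
      · obtain rfl : j = j' := Fin.ext h'
        have h1 := finrank_stairCode_inf (hle₁ (i, j)) (hle₂ (i, j)) A.1.1 A'.1.1 A.1.2 A'.1.2
          R.1 R'.1
        refine le_trans (Nat.add_le_add_left ?_ _) h1
        -- Equal shifts: if the pairs `(P, S)` differ, the pair code supplies rank `δ`; otherwise
        -- the `R` differ and their MRD code does.
        by_cases hA : A = A'
        · refine (hG (i, j) (R.1 - R'.1) (Submodule.sub_mem _ R.2.1 R'.2.1) fun h0 => hne ?_).trans
            (finrank_range_le_stairMap _ _ _)
          rw [hA, Subtype.ext (sub_eq_zero.1 h0)]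
        · exact (hS (i, j) (A.1 - A'.1) (Submodule.sub_mem _ A.2 A'.2) fun h0 =>
            hA (Subtype.ext (sub_eq_zero.1 h0))).trans (finrank_range_add_le_stairMap _ _ _)
      · rw [inf_comm]
        exact finrank_stairCode_inf_add_le_of_right (hle₁ (i, j')) (hle₂ (i, j')) (hle₁ (i, j))
          (hle₂ (i, j)) (hmul h')
    · rw [inf_comm]
      exact finrank_stairCode_inf_add_le_of_left (hle₁ p') (hle₂ p') (hle₁ p) hδκ (hmul h)
  · exact le_finrank_stairCode_inf_ker_left (hle₁ w.1) (hle₂ w.1)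
  · have h := w.2.2.2.2
    exact le_finrank_stairCode_inf_ker_right (hle₁ w.1) (hle₂ w.1) (by omega) ho
  · rw [Nat.card_sigma, Nat.cast_sum, Fintype.sum_prod_type, Finset.mul_sum, Finset.sum_range]
    refine Finset.sum_congr rfl fun i _ => ?_
    rw [Finset.mul_sum, Finset.sum_range]
    refine Finset.sum_congr rfl fun j _ => ?_
    rw [Nat.card_prod, Nat.cast_mul, hGcard (i, j), hScard (i, j), Nat.cast_pow, mul_comm]

end Families

end CDC

/-! ### Union of the three families. -/

theorem mainTheorem4 {F : Type*} [Field F] [Finite F] (q : ℕ) (hq : Nat.card F = q)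
    (n n₁ n₂ k δ : ℕ) (hn : n = n₁ + n₂) (hn₁ : k ≤ n₁) (hn₂ : k ≤ n₂)
    (hk : 2 * δ ≤ k) (hδ : 4 ≤ 2 * δ)
    (T₁ : Finset ℕ) (hT₁ : T₁.Nonempty) (hT₁sub : T₁ ⊆ Finset.Icc δ k)
    (hgap : CDC.minGap T₁ < 2 * δ)
    (τ : ℕ) (hτ : τ = T₁.min' hT₁) (hτn : n₁ + k - τ ≤ n - k)
    (θ₁ θ₂ : ℕ) (hθ₁ : θ₁ = (n₁ - τ) / δ)
    (hθ₂ : θ₂ = min (k / δ - 1) ((n₂ - k + τ) / δ - 2))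
    (Λ₁ Γ Λ₃ : ℕ → ℕ)
    (hΛ₁ : ∀ i ≤ θ₁, Λ₁ i = max (k - δ) (n₁ - τ + δ - i * δ))
    (hΓ : ∀ i ≤ θ₁, Γ i = min (k - δ) (n₁ - τ + δ - i * δ))
    (hΛ₃ : ∀ j ≤ θ₂, Λ₃ j = n₂ - k + τ - (j + 1) * δ)
    (d₁ d₂ : ℕ → ℕ → ℕ)
    (hd₁ : ∀ i ≤ θ₁, ∀ j ≤ θ₂,
      d₁ i j = if Λ₃ j ≤ Λ₁ i then ⌈(δ : ℚ) / 2⌉₊ else ⌊(δ : ℚ) / 2⌋₊)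
    (hd₂ : ∀ i ≤ θ₁, ∀ j ≤ θ₂, d₂ i j = δ - d₁ i j)
    (X₁ : Set (Submodule F (Fin n₁ → F)))
    (hX₁ : CDC.IsMDDC X₁ (2 * δ) (2 * δ - CDC.minGap T₁) T₁) :
    (CDC.maxCDC F n (2 * δ) k : ℚ) ≥
      ∑ t ∈ T₁, (CDC.eta X₁ t : ℚ) * CDC.mrdSize q k (n₂ + t - k) δ
      + CDC.mrdSizeRestr q k (n - k) δ (k - δ)
      + CDC.mrdSizeRestr q (k - δ) (n₂ - k + τ - δ) δ (k - 2 * δ) *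
        ∑ i ∈ Finset.range (θ₁ + 1), ∑ j ∈ Finset.range (θ₂ + 1),
          (q : ℚ) ^ (min (Λ₁ i * d₂ i j) (Λ₃ j * d₁ i j)
            + Λ₁ i * (Γ i - δ + 1) + Λ₃ j) := by
  subst hq
  have hτmem : τ ∈ T₁ := hτ ▸ T₁.min'_mem hT₁
  have hτle : ∀ t ∈ T₁, τ ≤ t := fun t ht => hτ ▸ T₁.min'_le t ht
  have hTk : ∀ t ∈ T₁, t ≤ k := fun t ht => (Finset.mem_Icc.1 (hT₁sub ht)).2
  have hτk : τ ≤ k := hTk τ hτmem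
  have hδ1 : 1 ≤ δ := by omega
  obtain ⟨a, rfl⟩ : ∃ a, n = a + k := ⟨n - k, by omega⟩
  rw [Nat.add_sub_cancel] at hτn ⊢
  have hθ₁' : ∀ i ≤ θ₁, i * δ ≤ n₁ - τ := fun i hi =>
    (Nat.le_div_iff_mul_le hδ1).1 (hi.trans hθ₁.le)
  have hθ₂' : ∀ j ≤ θ₂, (j + 2) * δ ≤ n₂ - k + τ := fun j hj => by
    refine (Nat.le_div_iff_mul_le hδ1).1 ?_
    have h1 : j ≤ (n₂ - k + τ) / δ - 2 := (hj.trans hθ₂.le).trans (min_le_right _ _)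
    -- From `n₁ + k - τ ≤ n - k` one gets `n₂ - k + τ ≥ k ≥ 2 * δ`, so the `- 2` in `θ₂` does not
    -- truncate.
    have h2 : 2 ≤ (n₂ - k + τ) / δ := (Nat.le_div_iff_mul_le hδ1).2 (by omega)
    omega
  have hd : ∀ i ≤ θ₁, ∀ j ≤ θ₂, 1 ≤ d₁ i j ∧ 1 ≤ d₂ i j ∧ d₁ i j + d₂ i j = δ := by
    intro i hi j hj
    have h2 : (2 : ℚ) ≤ δ := by exact_mod_cast (by omega : 2 ≤ δ)
    -- Since `δ ≥ 2`, both halves of `δ` are at least `1`, as the pair code requires.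
    have hceil : ⌈(δ : ℚ) / 2⌉₊ ≤ δ - 1 := by
      rw [Nat.ceil_le, Nat.cast_sub hδ1]
      push_cast
      linarith
    have hfloor : 1 ≤ ⌊(δ : ℚ) / 2⌋₊ := by
      refine Nat.le_floor ?_
      push_cast
      linarith
    have hfc := Nat.floor_le_ceil ((δ : ℚ) / 2)
    rw [hd₂ i hi j hj, hd₁ i hi j hj]
    split_ifs <;> omega
  obtain ⟨I₁, _, W₁, hW₁, hker₁, hcard₁⟩ := CDC.exists_packing_lift (n := a + k) (δ := δ) hn hδ1
    (by omega) (by omega : 2 * k ≤ n₂ + τ) hτle hTk hgap hX₁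
  obtain ⟨I₂, _, W₂, hW₂, hker₂, hleft₂, hcard₂⟩ :=
    CDC.exists_packing_rev (F := F) (a := a) (k := k) hδ1 (by omega) (by omega)
  obtain ⟨I₃, _, W₃, hW₃, hleft₃, hright₃, hcard₃⟩ := CDC.exists_packing_stair (F := F) (n := a + k)
    (N := n₁ + k - τ) (N' := n₂ - k + τ) (κ := k - δ) (δ := δ) (θ₁ := θ₁) (θ₂ := θ₂)
    (l := fun i => n₁ - τ + δ - i * δ) (m := fun j => n₂ - k + τ - (j + 1) * δ) (d₁ := d₁)
    (d₂ := d₂) (by omega) hδ1 (by omega) (by omega)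
    (fun i hi => by have := hθ₁' i hi; omega) (fun i hi => by have := hθ₁' i hi; omega)
    (fun j hj => by have := hθ₂' j hj; simp only [Nat.add_mul] at *; omega)
    (fun j hj => by have := hθ₂' j hj; simp only [Nat.add_mul] at *; omega) hd
  rw [Nat.sub_add_cancel (by omega)] at hW₃
  have h₁₂ : ∀ i j, Module.finrank F (W₁ i ⊓ W₂ j : Submodule F (Fin (a + k) → F)) + δ ≤ k :=
    fun i j => (CDC.finrank_inf_add_le_of_ker (hker₁ i a hτn) (hleft₂ j)).trans
      (hW₂.finrank_eq j).le
  have h₁₃ : ∀ i j, Module.finrank F (W₁ i ⊓ W₃ j : Submodule F (Fin (a + k) → F)) + δ ≤ k :=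
    fun i j => (CDC.finrank_inf_add_le_of_ker (hker₁ i (n₁ + k - τ) le_rfl) (hleft₃ j)).trans
      (hW₃.finrank_eq j).le
  have h₂₃ : ∀ i j, Module.finrank F (W₂ i ⊓ W₃ j : Submodule F (Fin (a + k) → F)) + δ ≤ k :=
    fun i j => (CDC.finrank_inf_add_le_of_ker (hker₂ i) (hright₃ j a k hτn)).trans
      (hW₃.finrank_eq j).le
  have hW := (hW₁.sumElim hW₂ h₁₂).sumElim hW₃ (Sum.rec h₁₃ h₂₃)
  have hpos : 0 < CDC.eta X₁ τ := (hX₁.dims τ).2 hτmem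
  -- A code must be nonempty; `X₁` has a codeword of dimension `τ`.
  have hne : Nonempty I₁ := by
    rw [← Finite.card_pos_iff, hcard₁]
    exact Finset.sum_pos' (fun _ _ => Nat.zero_le _)
      ⟨τ, hτmem, Nat.mul_pos hpos (Nat.pow_pos Finite.card_pos)⟩
  have hmain := hW.natCard_le_maxCDC hδ1
  rw [Nat.card_sum, Nat.card_sum] at hmain
  have hmain' : (Nat.card I₁ + Nat.card I₂ + Nat.card I₃ : ℚ) ≤
      CDC.maxCDC F (a + k) (2 * δ) k := by
    exact_mod_cast hmain
  refine ge_iff_le.2 (le_trans (le_of_eq ?_) hmain')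
  rw [hcard₁, hcard₂, hcard₃, show k - δ - δ = k - 2 * δ by omega]
  push_cast
  congr 2
  refine Finset.sum_congr rfl fun i hi => Finset.sum_congr rfl fun j hj => ?_
  have hi' : i ≤ θ₁ := Nat.lt_succ_iff.1 (Finset.mem_range.1 hi)
  have hj' : j ≤ θ₂ := Nat.lt_succ_iff.1 (Finset.mem_range.1 hj)
  rw [hΛ₁ i hi', hΓ i hi', hΛ₃ j hj']
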